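/- **Setting.** Let $N\ge 0$, $d\ge 0$, $p\ge 0$ be integers and let $X=(X_{t_0},\dots,X_{t_N})$ be random vectors in $\mathbb{R}^d$ such that, for $1\le j\le N-1$, $X_{t_j}\in[0,1]^d$ a.s. and $X_{t_j}$ has a density with respect to Lebesgue measure. Let $Z_{t_j}=h_j(X_{t_j})$ with $h_j$ measurable, and $\mathbb{E}[Z_{t_j}^2]<\infty$ for $1\le j\le N$. Let $(X^{(m)})_{m\ge1}$ be i.i.d. paths with the law of $X$ (no independence between $X$ and the sample is required). **Regression trees.** A depth-$p$ tree for a law $\mu$ of a pair $(x,y)\in\mathbb{R}^d\times\mathbb{R}$ is built from the box $[0,1)^d$ by $p$ rounds of splitting. To split a box $[a,b)=\prod_i[a_i,b_i)$ along a coordinate $i$ at a threshold $c\in[a_i,b_i]$ means to cut it into its parts $\{x_i<c\}$ and $\{x_i\ge c\}$. The *splitting choices* specify, for every split of the tree at every time $t_j$, the coordinate $i$ and whether $c$ is the midpoint $(a_i+b_i)/2$ or is optimised, that is, minimises over $[a_i,b_i]$ $$\int_{\{x\in[a,b)\}}\bigl(y-Y_L\mathbb{1}_{\{x_i<c\}}-Y_R\mathbb{1}_{\{x_i\ge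 c\}}\bigr)^2\,d\mu ,$$ where $Y_L,Y_R$ are the $\mu$-means of $y$ on the two parts. The tree is the function $\sum_{\text{leaves}}\alpha\,\mathbb{1}_{\{x\in\text{leaf}\}}$ on the $2^p$ final boxes, $\alpha$ being the $\mu$-mean of $y$ on the leaf (arbitrary if the leaf has $\mu$-mass $0$). The splitting choices are random (with any law, for instance uniform coordinates and midpoints with probability $q$), independent of $(X,(X^{(m)})_{m})$, and the same choices are used for all the trees below. **Idealized and Monte Carlo trees.** Set $\tau^p_N=t_N$ and recursively for $j=N-1,\dots,1$ let $\mathcal{T}_p^j(\cdot,\theta^p_j)$, with coefficients $\theta^p_j$, be a tree for the law of $(X_{t_j},Z_{\tau^p_{j+1}})$ given the splitting choices, and $\tau^p_j=t_j$ if $Z_{t_j}\ge\mathcal{T}_p^j(X_{t_j},\theta^p_j)$, $\tau^p_j=\tau^p_{j+1}$ otherwise. For $M\ge1$, let $\hat{\mathcal{T}}_p^{j,M}(\cdot,\hat\theta_j^{p,M})$ be the trees obtained by the same recursion when the law of $X$ is replaced by the empirical law $\frac1M\sum_{m=1}^M\delta_{X^{(m)}}$; any choice of minimisers is allowed. Assume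 that the idealized trees are well determined: almost surely with respect to the splitting choices, at every optimised split of a box of positive mass of an idealized tree, the minimising threshold is unique. **Proposition 4.7.** Assume that $\mathbb{P}\bigl(Z_{t_j}=\mathcal{T}_p^j(X_{t_j},\theta_j^p)\bigr)=0$ for all $1\le j\le N-1$. Then, for every $j=1,\dots,N-1$, $$\hat{\mathcal{T}}_p^{j,M}(X_{t_j},\hat\theta_j^{p,M})\longrightarrow\mathcal{T}_p^j(X_{t_j},\theta_j^p)\quad\text{almost surely as }M\to\infty .$$ -/

import Mathlib

open MeasureTheory ProbabilityTheory Filter Topology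
open scoped ENNReal

noncomputable section

namespace RegressionTreeLS

/-- The random choices made while growing a tree of depth `p` in dimension `d`: at every split the
coordinate `i` along which one splits, and whether the threshold is the midpoint (`mid = true`) or
is optimised (`mid = false`), followed by the choices in the lower and in the upper half. -/
inductive SplitPlan (d : ℕ) : ℕ → Type
  | leaf : SplitPlan d 0
  | node {p : ℕ} (i : Fin d) (mid : Bool) (l r : SplitPlan d p) : SplitPlan d (p + 1)

/-- There are finitely many plans of a given depth; they carry the discrete σ-algebra. -/
instance (d p : ℕ) : MeasurableSpace (SplitPlan d p) := ⊤

/-- The coefficients of a binary tree of depth `p` with `2 ^ p` leaves: a direction and a threshold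
at each split, a real value at each leaf. -/
inductive RegTree (d : ℕ) : ℕ → Type
  | leaf (α : ℝ) : RegTree d 0
  | node {p : ℕ} (i : Fin d) (a : ℝ) (l r : RegTree d p) : RegTree d (p + 1)

/-- The half-open box `[lo, hi) = ∏ i, [lo i, hi i)`. -/
def box {d : ℕ} (lo hi : Fin d → ℝ) : Set (Fin d → ℝ) :=
  Set.univ.pi fun i => Set.Ico (lo i) (hi i)

/-- The piecewise constant function `∑ (leaves) α • 𝟙_{cell}` on the box `[lo, hi)`, where the cells
are obtained by cutting the box successively at the thresholds of the tree. -/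
def RegTree.eval {d : ℕ} : {p : ℕ} → RegTree d p → (lo hi : Fin d → ℝ) → (Fin d → ℝ) → ℝ
  | _, .leaf α, lo, hi, x => (box lo hi).indicator (fun _ => α) x
  | _, .node i a l r, lo, hi, x =>
      l.eval lo (Function.update hi i a) x + r.eval (Function.update lo i a) hi x

/-- `E[Y | X ∈ [lo, hi)]` when `μ` is the law of `(X, Y)`; the sample mean of the `Y`'s with
`X ∈ [lo, hi)` when `μ` is an empirical law. -/
def cellMean {d : ℕ} (μ : Measure ((Fin d → ℝ) × ℝ)) (lo hi : Fin d → ℝ) : ℝ :=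
  ⨍ z in {z | z.1 ∈ box lo hi}, z.2 ∂μ

/-- The squared error on the box `[lo, hi)` when it is cut along coordinate `i` at `a` and the
target is replaced by its mean `Y_L` on the lower part and its mean `Y_R` on the upper part. -/
def splitError {d : ℕ} (μ : Measure ((Fin d → ℝ) × ℝ)) (lo hi : Fin d → ℝ) (i : Fin d) (a : ℝ) :
    ℝ :=
  ∫ z in {z | z.1 ∈ box lo hi},
    (z.2 - if z.1 i < a then cellMean μ lo (Function.update hi i a)
      else cellMean μ (Function.update lo i a) hi) ^ 2 ∂μ

/-- `IsGrown μ plan t lo hi`: the tree `t` is grown on the box `[lo, hi)` from the law `μ` of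
`(X, Y)`, following the choices of `plan`. A threshold is the midpoint of the side that is cut, or
a minimiser of the squared error over that side; the value at a leaf is the mean of `Y` on its cell
(no condition if the cell has mass zero, where the mean is `0 / 0`). -/
def IsGrown {d : ℕ} (μ : Measure ((Fin d → ℝ) × ℝ)) :
    {p : ℕ} → SplitPlan d p → RegTree d p → (lo hi : Fin d → ℝ) → Prop
  | _, .leaf, .leaf α, lo, hi => μ {z | z.1 ∈ box lo hi} ≠ 0 → α = cellMean μ lo hi
  | _, .node i mid pl pr, .node i' a l r, lo, hi =>
      i' = i ∧
      (mid = true → a = (lo i + hi i) / 2) ∧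
      (mid = false → a ∈ Set.Icc (lo i) (hi i) ∧
        ∀ b ∈ Set.Icc (lo i) (hi i), splitError μ lo hi i a ≤ splitError μ lo hi i b) ∧
      IsGrown μ pl l lo (Function.update hi i a) ∧
      IsGrown μ pr r (Function.update lo i a) hi

/-- At every optimised split of a cell of positive mass, the threshold of the tree is the only
minimiser of the squared error. -/
def HasUniqueSplits {d : ℕ} (μ : Measure ((Fin d → ℝ) × ℝ)) :
    {p : ℕ} → SplitPlan d p → RegTree d p → (lo hi : Fin d → ℝ) → Prop
  | _, .leaf, .leaf _, _, _ => True
  | _, .node i mid pl pr, .node _ a l r, lo, hi =>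
      (mid = false → μ {z | z.1 ∈ box lo hi} ≠ 0 →
        ∀ b ∈ Set.Icc (lo i) (hi i), splitError μ lo hi i b ≤ splitError μ lo hi i a → b = a) ∧
      HasUniqueSplits μ pl l lo (Function.update hi i a) ∧
      HasUniqueSplits μ pr r (Function.update lo i a) hi

/-- A path `(x_0, …, x_N)` of the underlying process at the dates `t_0 < … < t_N`. -/
abbrev Path (N d : ℕ) : Type := Fin (N + 1) → Fin d → ℝ

/-- The tree function `x ↦ 𝒯(x)` on `[0, 1)^d`. -/
def treeFun {d p : ℕ} (t : RegTree d p) (x : Fin d → ℝ) : ℝ := t.eval 0 1 x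

/-- The index of the exercise date `τ_j` of the policy given by the trees: `τ_N = t_N`, and for
`j < N`, `τ_j = t_j` if `Z_j = h_j(x_j) ≥ 𝒯^j(x_j)` and `τ_j = τ_{j+1}` otherwise. -/
def exerciseDate {N d p : ℕ} (h : Fin (N + 1) → (Fin d → ℝ) → ℝ) (t : Fin N → RegTree d p)
    (x : Path N d) (j : Fin (N + 1)) : Fin (N + 1) :=
  Fin.reverseInduction (motive := fun _ => Fin (N + 1)) (Fin.last N)
    (fun k τ => if treeFun (t k) (x k.castSucc) ≤ h k.castSucc (x k.castSucc)
      then k.castSucc else τ) j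

/-- The cash flow `Z_{τ_j}` along the path `x`. -/
def cashFlow {N d p : ℕ} (h : Fin (N + 1) → (Fin d → ℝ) → ℝ) (t : Fin N → RegTree d p)
    (x : Path N d) (j : Fin (N + 1)) : ℝ :=
  h (exerciseDate h t x j) (x (exerciseDate h t x j))

/-- The law of `(X_{t_j}, Z_{τ_{j+1}})`, the data of the regression at time `t_j`, when the path of
the process has law `Q`. -/
def regressionLaw {N d p : ℕ} (Q : Measure (Path N d)) (h : Fin (N + 1) → (Fin d → ℝ) → ℝ)
    (t : Fin N → RegTree d p) (j : Fin N) : Measure ((Fin d → ℝ) × ℝ) :=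
  Q.map fun x => (x j.castSucc, cashFlow h t x j.succ)

/-- `t` is the family of trees `(𝒯^j)`, `1 ≤ j ≤ N - 1`, which the Longstaff–Schwartz algorithm
produces by backward recursion when paths have law `Q` and the splits follow `plan`. With `Q` the
law of the process these are the idealized trees; with `Q` the empirical law of `M` sampled
paths they are the Monte Carlo trees. (The component `j = 0` plays no role.) -/
def IsLSTrees {N d p : ℕ} (Q : Measure (Path N d)) (h : Fin (N + 1) → (Fin d → ℝ) → ℝ)
    (plan : Fin N → SplitPlan d p) (t : Fin N → RegTree d p) : Prop :=
  ∀ j : Fin N, 0 < (j : ℕ) → IsGrown (regressionLaw Q h t j) (plan j) (t j) 0 1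

/-- The empirical law `M⁻¹ ∑_{m < M} δ_{x m}`. -/
def empiricalLaw {N d : ℕ} (x : ℕ → Path N d) (M : ℕ) : Measure (Path N d) :=
  (M : ℝ≥0∞)⁻¹ • ∑ m ∈ Finset.range M, Measure.dirac (x m)

end RegressionTreeLS

end

namespace RegressionTreeLS

/-! The difficulty is that a Monte Carlo tree is fitted to cash flows which themselves depend on the
sample through the later Monte Carlo trees, so no law of large numbers applies to them directly. It
is applied instead to the idealized cash flows, uniformly over small perturbations of a box
(`ae_boxLLN`). The price of the substitution is at most twice the empirical mass, weighted by
`weight`, of the paths on which the two exercise policies differ. A backward induction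
(`SampleLLN.momentConv`) shows that this mass vanishes: convergent later trees take the same
decisions except near ties, and ties are null.

A tree depends on its law only through box moments of order at most two. If these converge,
optimised thresholds converge by compactness and uniqueness (`MomentConv.tendsto_threshold`), and
leaf means converge on cells of positive mass.

Trees converge only off cell boundaries and null cells, so `IsGrown.exists_cells_tendsto_eval` is
stated along an arbitrary filter that avoids these. It is used twice: along `empiricalFilter`, to
compare policies over the sample, and along a fixed point, to obtain the conclusion at `X ω`. Once
the laws of large numbers hold, the argument is deterministic, hence indifferent to the choice of
minimisers. The random splitting choices take countably many values and are frozen one at a time. -/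

theorem measurableSet_box {d : ℕ} (lo hi : Fin d → ℝ) : MeasurableSet (box lo hi) :=
  MeasurableSet.univ_pi fun _ => measurableSet_Ico

theorem measurableSet_fst_box {d : ℕ} (lo hi : Fin d → ℝ) :
    MeasurableSet {z : (Fin d → ℝ) × ℝ | z.1 ∈ box lo hi} :=
  measurable_fst (measurableSet_box lo hi)

theorem mem_box {d : ℕ} {lo hi x : Fin d → ℝ} :
    x ∈ box lo hi ↔ ∀ i, lo i ≤ x i ∧ x i < hi i := by
  simp [box, Set.mem_pi]

theorem mem_box_lower {d : ℕ} {lo hi x : Fin d → ℝ} {i : Fin d} {a : ℝ} (ha : a ≤ hi i) :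
    x ∈ box lo (Function.update hi i a) ↔ x ∈ box lo hi ∧ x i < a := by
  simp only [mem_box]
  constructor
  · intro h
    refine ⟨fun k => ⟨(h k).1, ?_⟩, by simpa using (h i).2⟩
    by_cases hk : k = i
    · subst hk; have := (h k).2; simp at this; linarith
    · have := (h k).2; simpa [hk] using this
  · rintro ⟨h, h'⟩ k
    refine ⟨(h k).1, ?_⟩
    by_cases hk : k = i
    · subst hk; simpa using h'
    · simpa [hk] using (h k).2

theorem mem_box_upper {d : ℕ} {lo hi x : Fin d → ℝ} {i : Fin d} {a : ℝ} (ha : lo i ≤ a) :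
    x ∈ box (Function.update lo i a) hi ↔ x ∈ box lo hi ∧ a ≤ x i := by
  simp only [mem_box]
  constructor
  · intro h
    refine ⟨fun k => ⟨?_, (h k).2⟩, by simpa using (h i).1⟩
    by_cases hk : k = i
    · subst hk; have := (h k).1; simp at this; linarith
    · have := (h k).1; simpa [hk] using this
  · rintro ⟨h, h'⟩ k
    refine ⟨?_, (h k).2⟩
    by_cases hk : k = i
    · subst hk; simpa using h'
    · simpa [hk] using (h k).1

/-! ### Box moments and the squared error of a split. -/

/-- The moment of order `k` of the target on the box `[lo, hi)`. -/
noncomputable def boxMoment {d : ℕ} (μ : Measure ((Fin d → ℝ) × ℝ)) (k : ℕ) (lo hi : Fin d → ℝ) :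
    ℝ :=
  ∫ z in {z | z.1 ∈ box lo hi}, z.2 ^ k ∂μ

theorem boxMoment_zero_eq {d : ℕ} (μ : Measure ((Fin d → ℝ) × ℝ)) (lo hi : Fin d → ℝ) :
    boxMoment μ 0 lo hi = μ.real {z | z.1 ∈ box lo hi} := by
  simp [boxMoment]

theorem boxMoment_of_null {d : ℕ} {μ : Measure ((Fin d → ℝ) × ℝ)} {k : ℕ} {lo hi : Fin d → ℝ}
    (h : μ {z | z.1 ∈ box lo hi} = 0) : boxMoment μ k lo hi = 0 := by
  simp [boxMoment, Measure.restrict_eq_zero.2 h]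

theorem boxMoment_zero_eq_zero_iff {d : ℕ} {μ : Measure ((Fin d → ℝ) × ℝ)} [IsFiniteMeasure μ]
    {lo hi : Fin d → ℝ} : boxMoment μ 0 lo hi = 0 ↔ μ {z | z.1 ∈ box lo hi} = 0 := by
  rw [boxMoment_zero_eq, measureReal_eq_zero_iff]

theorem cellMean_eq {d : ℕ} (μ : Measure ((Fin d → ℝ) × ℝ)) (lo hi : Fin d → ℝ) :
    cellMean μ lo hi = boxMoment μ 1 lo hi / boxMoment μ 0 lo hi := by
  rw [cellMean, setAverage_eq, boxMoment_zero_eq, boxMoment, smul_eq_mul, div_eq_inv_mul]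
  simp

theorem integrable_snd_of_sq {d : ℕ} {μ : Measure ((Fin d → ℝ) × ℝ)} [IsFiniteMeasure μ]
    (h2 : Integrable (fun z => z.2 ^ 2) μ) : Integrable (fun z => z.2) μ := by
  have : MemLp (fun z : (Fin d → ℝ) × ℝ => z.2) 2 μ :=
    (memLp_two_iff_integrable_sq measurable_snd.aestronglyMeasurable).2 h2
  exact this.integrable (by norm_num)

theorem setIntegral_sub_sq {d : ℕ} {μ : Measure ((Fin d → ℝ) × ℝ)} [IsFiniteMeasure μ]
    (h2 : Integrable (fun z => z.2 ^ 2) μ) (lo hi : Fin d → ℝ) (c : ℝ) :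
    ∫ z in {z | z.1 ∈ box lo hi}, (z.2 - c) ^ 2 ∂μ =
      boxMoment μ 2 lo hi - 2 * c * boxMoment μ 1 lo hi + c ^ 2 * boxMoment μ 0 lo hi := by
  have h1 := integrable_snd_of_sq h2
  have e : ∀ z : (Fin d → ℝ) × ℝ, (z.2 - c) ^ 2 = (z.2 ^ 2 - 2 * c * z.2 ^ 1) + c ^ 2 * z.2 ^ 0 :=
    fun z => by ring
  simp_rw [e]
  have h1' : Integrable (fun z => 2 * c * z.2 ^ 1) (μ.restrict {z | z.1 ∈ box lo hi}) := by
    simp only [pow_one]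
    exact (h1.const_mul (2 * c)).integrableOn
  have h12 : Integrable (fun z => z.2 ^ 2 - 2 * c * z.2 ^ 1)
      (μ.restrict {z | z.1 ∈ box lo hi}) := h2.integrableOn.sub h1'
  rw [integral_add h12 (by simp),
    integral_sub h2.integrableOn h1',
    integral_const_mul, integral_const_mul]
  rfl

theorem setIntegral_sub_cellMean_sq {d : ℕ} {μ : Measure ((Fin d → ℝ) × ℝ)} [IsFiniteMeasure μ]
    (h2 : Integrable (fun z => z.2 ^ 2) μ) (lo hi : Fin d → ℝ) :
    ∫ z in {z | z.1 ∈ box lo hi}, (z.2 - cellMean μ lo hi) ^ 2 ∂μ =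
      boxMoment μ 2 lo hi - boxMoment μ 1 lo hi ^ 2 / boxMoment μ 0 lo hi := by
  rw [setIntegral_sub_sq h2, cellMean_eq]
  by_cases h0 : boxMoment μ 0 lo hi = 0
  · simp [h0]
  · field_simp; ring

/-- Cauchy–Schwarz, read off from the nonnegative residual variance. It controls the energy of cells
whose mass tends to zero. -/
theorem sq_boxMoment_div_le {d : ℕ} {μ : Measure ((Fin d → ℝ) × ℝ)} [IsFiniteMeasure μ]
    (h2 : Integrable (fun z => z.2 ^ 2) μ) (lo hi : Fin d → ℝ) :
    boxMoment μ 1 lo hi ^ 2 / boxMoment μ 0 lo hi ≤ boxMoment μ 2 lo hi := by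
  have := setIntegral_sub_cellMean_sq h2 lo hi
  have h : 0 ≤ ∫ z in {z | z.1 ∈ box lo hi}, (z.2 - cellMean μ lo hi) ^ 2 ∂μ :=
    integral_nonneg fun _ => sq_nonneg _
  linarith

theorem sq_boxMoment_div_nonneg {d : ℕ} (μ : Measure ((Fin d → ℝ) × ℝ)) (lo hi : Fin d → ℝ) :
    0 ≤ boxMoment μ 1 lo hi ^ 2 / boxMoment μ 0 lo hi := by
  rw [boxMoment_zero_eq]; positivity

theorem fst_box_eq_union {d : ℕ} {lo hi : Fin d → ℝ} {i : Fin d} {a : ℝ}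
    (ha : a ∈ Set.Icc (lo i) (hi i)) :
    {z : (Fin d → ℝ) × ℝ | z.1 ∈ box lo hi} = {z | z.1 ∈ box lo (Function.update hi i a)} ∪
      {z | z.1 ∈ box (Function.update lo i a) hi} := by
  ext z
  simp only [Set.mem_ofPred_eq, Set.mem_union, mem_box_lower ha.2, mem_box_upper ha.1]
  have := lt_or_ge (z.1 i) a
  tauto

theorem disjoint_fst_box {d : ℕ} {lo hi : Fin d → ℝ} {i : Fin d} {a : ℝ}
    (ha : a ∈ Set.Icc (lo i) (hi i)) :
    Disjoint {z : (Fin d → ℝ) × ℝ | z.1 ∈ box lo (Function.update hi i a)}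
      {z | z.1 ∈ box (Function.update lo i a) hi} := by
  refine Set.disjoint_left.2 fun z h1 h2 => ?_
  simp only [Set.mem_ofPred_eq, mem_box_lower ha.2, mem_box_upper ha.1] at h1 h2
  linarith [h1.2, h2.2]

/-- The squared error of a split is the second moment minus the energies of the two means. -/
theorem splitError_eq {d : ℕ} {μ : Measure ((Fin d → ℝ) × ℝ)} [IsFiniteMeasure μ]
    (h2 : Integrable (fun z => z.2 ^ 2) μ) {lo hi : Fin d → ℝ} {i : Fin d} {a : ℝ}
    (ha : a ∈ Set.Icc (lo i) (hi i)) :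
    splitError μ lo hi i a = boxMoment μ 2 lo hi
      - boxMoment μ 1 lo (Function.update hi i a) ^ 2 / boxMoment μ 0 lo (Function.update hi i a)
      - boxMoment μ 1 (Function.update lo i a) hi ^ 2
        / boxMoment μ 0 (Function.update lo i a) hi := by
  have h1 := integrable_snd_of_sq h2
  have hsq : ∀ c : ℝ, Integrable (fun z : (Fin d → ℝ) × ℝ => (z.2 - c) ^ 2) μ := fun c => by
    have e : ∀ z : (Fin d → ℝ) × ℝ, (z.2 - c) ^ 2 = (z.2 ^ 2 - 2 * c * z.2) + c ^ 2 :=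
      fun z => by ring
    simp_rw [e]
    exact (h2.sub (h1.const_mul _)).add (integrable_const _)
  have eL : Set.EqOn (fun z : (Fin d → ℝ) × ℝ => (z.2 - if z.1 i < a
      then cellMean μ lo (Function.update hi i a) else cellMean μ (Function.update lo i a) hi) ^ 2)
      (fun z => (z.2 - cellMean μ lo (Function.update hi i a)) ^ 2)
      {z | z.1 ∈ box lo (Function.update hi i a)} := fun z hz => by
    simp only [Set.mem_ofPred_eq, mem_box_lower ha.2] at hz
    simp [hz.2]
  have eR : Set.EqOn (fun z : (Fin d → ℝ) × ℝ => (z.2 - if z.1 i < a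
      then cellMean μ lo (Function.update hi i a) else cellMean μ (Function.update lo i a) hi) ^ 2)
      (fun z => (z.2 - cellMean μ (Function.update lo i a) hi) ^ 2)
      {z | z.1 ∈ box (Function.update lo i a) hi} := fun z hz => by
    simp only [Set.mem_ofPred_eq, mem_box_upper ha.1] at hz
    simp [hz.2.not_gt]
  have hm2 : boxMoment μ 2 lo hi = boxMoment μ 2 lo (Function.update hi i a) +
      boxMoment μ 2 (Function.update lo i a) hi := by
    rw [boxMoment, fst_box_eq_union ha, setIntegral_union (disjoint_fst_box ha)
      (measurableSet_fst_box _ _) h2.integrableOn h2.integrableOn]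
    rfl
  rw [hm2, splitError, fst_box_eq_union ha, setIntegral_union (disjoint_fst_box ha)
    (measurableSet_fst_box _ _) ((integrableOn_congr_fun eL (measurableSet_fst_box _ _)).2
      (hsq _).integrableOn) ((integrableOn_congr_fun eR (measurableSet_fst_box _ _)).2
      (hsq _).integrableOn), setIntegral_congr_fun (measurableSet_fst_box _ _) eL,
    setIntegral_congr_fun (measurableSet_fst_box _ _) eR, setIntegral_sub_cellMean_sq h2,
    setIntegral_sub_cellMean_sq h2]
  ring

/-! ### Convergence of moments, means and thresholds. -/

/-- Convergence of the moments of order at most two of the target on boxes, locally uniformly in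
the box. -/
structure MomentConv {d : ℕ} (μs : ℕ → Measure ((Fin d → ℝ) × ℝ))
    (μ : Measure ((Fin d → ℝ) × ℝ)) : Prop where
  finite : IsFiniteMeasure μ
  finite_seq : ∀ M, IsFiniteMeasure (μs M)
  integrable_sq : Integrable (fun z => z.2 ^ 2) μ
  integrable_sq_seq : ∀ M, Integrable (fun z => z.2 ^ 2) (μs M)
  tendsto : ∀ k ≤ 2, ∀ lo hi : Fin d → ℝ,
    Tendsto (fun z : ℕ × ((Fin d → ℝ) × (Fin d → ℝ)) => boxMoment (μs z.1) k z.2.1 z.2.2)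
      (atTop ×ˢ 𝓝 (lo, hi)) (𝓝 (boxMoment μ k lo hi))

namespace MomentConv

variable {d : ℕ} {μs : ℕ → Measure ((Fin d → ℝ) × ℝ)} {μ : Measure ((Fin d → ℝ) × ℝ)}
  {l : Filter ℕ} {los his : ℕ → Fin d → ℝ} {lo hi : Fin d → ℝ}

/-- Any filter below `atTop` is allowed, so that ultrafilters can be used for `tendsto_threshold`.
-/
theorem tendsto_along (H : MomentConv μs μ) {k : ℕ} (hk : k ≤ 2) (hl : l ≤ atTop)
    (hlo : Tendsto los l (𝓝 lo)) (hhi : Tendsto his l (𝓝 hi)) :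
    Tendsto (fun M => boxMoment (μs M) k (los M) (his M)) l (𝓝 (boxMoment μ k lo hi)) := by
  have key : Tendsto (fun M => (M, (los M, his M))) l (atTop ×ˢ 𝓝 (lo, hi)) :=
    Tendsto.prodMk (show Tendsto id l atTop from hl) (hlo.prodMk_nhds hhi)
  have h := Tendsto.comp (H.tendsto k hk lo hi) key
  simpa only [Function.comp_def] using h

/-- If the limiting box is null the quotient tends to `0 / 0`; there the energy is squeezed between
0 and the second moment, which vanishes. Hence split errors converge even when one side of the split
is null. -/
theorem tendsto_energy (H : MomentConv μs μ) (hl : l ≤ atTop)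
    (hlo : Tendsto los l (𝓝 lo)) (hhi : Tendsto his l (𝓝 hi)) :
    Tendsto (fun M => boxMoment (μs M) 1 (los M) (his M) ^ 2 / boxMoment (μs M) 0 (los M) (his M))
      l (𝓝 (boxMoment μ 1 lo hi ^ 2 / boxMoment μ 0 lo hi)) := by
  have := H.finite
  have := H.finite_seq
  by_cases h0 : boxMoment μ 0 lo hi = 0
  · have h2 := H.tendsto_along le_rfl hl hlo hhi
    rw [boxMoment_of_null (boxMoment_zero_eq_zero_iff.1 h0)] at h2
    rw [h0, div_zero]
    exact squeeze_zero (fun M => sq_boxMoment_div_nonneg _ _ _)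
      (fun M => sq_boxMoment_div_le (H.integrable_sq_seq M) _ _) h2
  · exact ((H.tendsto_along (by norm_num) hl hlo hhi).pow 2).div
      (H.tendsto_along (by norm_num) hl hlo hhi) h0

theorem tendsto_splitError (H : MomentConv μs μ) (hl : l ≤ atTop)
    (hlo : Tendsto los l (𝓝 lo)) (hhi : Tendsto his l (𝓝 hi)) {i : Fin d} {as : ℕ → ℝ} {a : ℝ}
    (has : Tendsto as l (𝓝 a)) (hmem : ∀ᶠ M in l, as M ∈ Set.Icc (los M i) (his M i))
    (ha : a ∈ Set.Icc (lo i) (hi i)) :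
    Tendsto (fun M => splitError (μs M) (los M) (his M) i (as M)) l
      (𝓝 (splitError μ lo hi i a)) := by
  have := H.finite
  have := H.finite_seq
  rw [splitError_eq H.integrable_sq ha]
  refine Tendsto.congr' (hmem.mono fun M hM => (splitError_eq (H.integrable_sq_seq M) hM).symm) ?_
  exact ((H.tendsto_along le_rfl hl hlo hhi).sub
    (H.tendsto_energy hl hlo (hhi.update i has))).sub (H.tendsto_energy hl (hlo.update i has) hhi)

/-- Minimisers of the empirical squared error converge to the minimiser of the limit when the
latter is unique. -/
theorem tendsto_threshold (H : MomentConv μs μ)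
    (hlo : Tendsto los atTop (𝓝 lo)) (hhi : Tendsto his atTop (𝓝 hi)) {i : Fin d}
    (hle : ∀ᶠ M in atTop, los M i ≤ his M i) {as : ℕ → ℝ} {a : ℝ}
    (has : ∀ᶠ M in atTop, as M ∈ Set.Icc (los M i) (his M i) ∧
      ∀ b ∈ Set.Icc (los M i) (his M i),
        splitError (μs M) (los M) (his M) i (as M) ≤ splitError (μs M) (los M) (his M) i b)
    (ha : a ∈ Set.Icc (lo i) (hi i))
    (huniq : ∀ b ∈ Set.Icc (lo i) (hi i),
      splitError μ lo hi i b ≤ splitError μ lo hi i a → b = a) :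
    Tendsto as atTop (𝓝 a) := by
  rw [tendsto_iff_ultrafilter]
  intro U hU
  have hloi : Tendsto (fun M => los M i) U (𝓝 (lo i)) :=
    ((continuous_apply i).tendsto _).comp (hlo.mono_left hU)
  have hhii : Tendsto (fun M => his M i) U (𝓝 (hi i)) :=
    ((continuous_apply i).tendsto _).comp (hhi.mono_left hU)
  have hmem : ∀ᶠ M in U, as M ∈ Set.Icc (los M i) (his M i) :=
    (has.filter_mono hU).mono fun M h => h.1
  -- The interval of admissible thresholds moves with `M`; enlarging its limit by 1 gives a fixed
  -- compact set that eventually contains it.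
  obtain ⟨b, -, hb⟩ : ∃ b ∈ Set.Icc (lo i - 1) (hi i + 1), Tendsto as U (𝓝 b) := by
    refine isCompact_Icc.ultrafilter_le_nhds (U.map as) ?_
    rw [le_principal_iff]
    change ∀ᶠ M in (U : Filter ℕ), as M ∈ Set.Icc (lo i - 1) (hi i + 1)
    filter_upwards [hmem, hloi.eventually (lt_mem_nhds (sub_one_lt (lo i))),
      hhii.eventually (gt_mem_nhds (lt_add_one (hi i)))] with M h1 h2 h3
    exact ⟨h2.le.trans h1.1, h1.2.trans h3.le⟩
  have hb' : b ∈ Set.Icc (lo i) (hi i) :=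
    ⟨le_of_tendsto_of_tendsto hloi hb (hmem.mono fun M h => h.1),
      le_of_tendsto_of_tendsto hb hhii (hmem.mono fun M h => h.2)⟩
  suffices b = a from this ▸ hb
  refine huniq b hb' ?_
  -- `a` may lie outside the moving interval, so its projection onto that interval serves as the
  -- competitor.
  have hclamp : Tendsto (fun M => max (los M i) (min (his M i) a)) U (𝓝 a) := by
    have := hloi.max (hhii.min (tendsto_const_nhds (x := a)))
    rwa [min_eq_right ha.2, max_eq_right ha.1] at this
  have hclamp_mem : ∀ᶠ M in U, max (los M i) (min (his M i) a) ∈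
      Set.Icc (los M i) (his M i) := (hle.filter_mono hU).mono fun M h =>
    ⟨le_max_left _ _, max_le h (min_le_left _ _)⟩
  refine le_of_tendsto_of_tendsto
    (H.tendsto_splitError hU (hlo.mono_left hU) (hhi.mono_left hU) hb hmem hb')
    (H.tendsto_splitError hU (hlo.mono_left hU) (hhi.mono_left hU) hclamp hclamp_mem ha) ?_
  filter_upwards [has.filter_mono hU, hclamp_mem] with M h1 h2 using h1.2 _ h2

theorem tendsto_cellMean (H : MomentConv μs μ)
    (hlo : Tendsto los atTop (𝓝 lo)) (hhi : Tendsto his atTop (𝓝 hi))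
    (h0 : μ {z | z.1 ∈ box lo hi} ≠ 0) :
    Tendsto (fun M => cellMean (μs M) (los M) (his M)) atTop (𝓝 (cellMean μ lo hi)) := by
  have := H.finite
  simp_rw [cellMean_eq]
  exact (H.tendsto_along (by norm_num) le_rfl hlo hhi).div
    (H.tendsto_along (by norm_num) le_rfl hlo hhi) (mt boxMoment_zero_eq_zero_iff.1 h0)

theorem eventually_measure_ne_zero (H : MomentConv μs μ)
    (hlo : Tendsto los atTop (𝓝 lo)) (hhi : Tendsto his atTop (𝓝 hi))
    (h0 : μ {z | z.1 ∈ box lo hi} ≠ 0) :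
    ∀ᶠ M in atTop, μs M {z | z.1 ∈ box (los M) (his M)} ≠ 0 := by
  have := H.finite
  have := H.finite_seq
  filter_upwards [(H.tendsto_along (Nat.zero_le 2) le_rfl hlo hhi).eventually_ne
    (mt boxMoment_zero_eq_zero_iff.1 h0)] with M hM
  exact mt boxMoment_zero_eq_zero_iff.2 hM

end MomentConv

/-! ### Convergence of grown trees. -/

theorem IsGrown.threshold_mem {d p : ℕ} {μ : Measure ((Fin d → ℝ) × ℝ)} {i i' : Fin d} {mid : Bool}
    {pl pr : SplitPlan d p} {a : ℝ} {l r : RegTree d p} {lo hi : Fin d → ℝ} (hle : lo ≤ hi)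
    (h : IsGrown μ (.node i mid pl pr) (.node i' a l r) lo hi) :
    a ∈ Set.Icc (lo i) (hi i) := by
  obtain ⟨-, h1, h2, -⟩ := h
  cases mid
  · exact (h2 rfl).1
  · have := hle i
    rw [h1 rfl]
    constructor <;> linarith

theorem le_update_hi {d : ℕ} {lo hi : Fin d → ℝ} {i : Fin d} {a : ℝ} (hle : lo ≤ hi)
    (ha : a ∈ Set.Icc (lo i) (hi i)) : lo ≤ Function.update hi i a := by
  rw [le_update_iff]
  exact ⟨ha.1, fun j _ => hle j⟩

theorem update_lo_le {d : ℕ} {lo hi : Fin d → ℝ} {i : Fin d} {a : ℝ} (hle : lo ≤ hi)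
    (ha : a ∈ Set.Icc (lo i) (hi i)) : Function.update lo i a ≤ hi := by
  rw [update_le_iff]
  exact ⟨ha.2, fun j _ => hle j⟩

/-- Growing keeps every threshold within the side it cuts, so all cells stay inside the box. With
arbitrary coefficients `eval` need not vanish outside. -/
theorem IsGrown.eval_eq_zero {d p : ℕ} {μ : Measure ((Fin d → ℝ) × ℝ)} (plan : SplitPlan d p)
    (t : RegTree d p) {lo hi x : Fin d → ℝ} (hle : lo ≤ hi) (h : IsGrown μ plan t lo hi)
    (hx : x ∉ box lo hi) : t.eval lo hi x = 0 := by
  induction plan generalizing lo hi with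
  | leaf =>
    cases t
    simp [RegTree.eval, hx]
  | node i mid pl pr ihl ihr =>
    cases t with
    | node i' a l r =>
      have ha := h.threshold_mem hle
      obtain ⟨rfl, -, -, hl, hr⟩ := h
      rw [RegTree.eval, ihl l (le_update_hi hle ha) hl
        (fun h => hx ((mem_box_lower ha.2).1 h).1), ihr r (update_lo_le hle ha) hr
        (fun h => hx ((mem_box_upper ha.1).1 h).1), add_zero]

/-- Along the filter `F` on pairs (step, point), membership in boxes converging to `[lo, hi)`
eventually agrees with membership in `[lo, hi)`, and a box without mass is eventually avoided. -/
structure Stable {d : ℕ} (F : Filter (ℕ × (Fin d → ℝ))) (μ : Measure ((Fin d → ℝ) × ℝ))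
    (lo hi : Fin d → ℝ) : Prop where
  mem_iff : ∀ los his : ℕ → Fin d → ℝ, Tendsto los atTop (𝓝 lo) → Tendsto his atTop (𝓝 hi) →
    ∀ᶠ z in F, (z.2 ∈ box (los z.1) (his z.1) ↔ z.2 ∈ box lo hi)
  not_mem : μ {z | z.1 ∈ box lo hi} = 0 → ∀ᶠ z in F, z.2 ∉ box lo hi

/-- Trees grown with the same choices from laws with converging box moments converge, in the sense
of any filter along which the finitely many cells of the limiting tree are stable. -/
theorem IsGrown.exists_cells_tendsto_eval {d p : ℕ} {μ : Measure ((Fin d → ℝ) × ℝ)}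
    (plan : SplitPlan d p) (t : RegTree d p) {lo hi : Fin d → ℝ} (hle : lo ≤ hi)
    (ht : IsGrown μ plan t lo hi) (huniq : HasUniqueSplits μ plan t lo hi) :
    ∃ C : Set ((Fin d → ℝ) × (Fin d → ℝ)), C.Finite ∧
      ∀ (μs : ℕ → Measure ((Fin d → ℝ) × ℝ)), MomentConv μs μ →
      ∀ (ts : ℕ → RegTree d p) (los his : ℕ → Fin d → ℝ),
        Tendsto los atTop (𝓝 lo) → Tendsto his atTop (𝓝 hi) → (∀ᶠ M in atTop, los M ≤ his M) →
        (∀ᶠ M in atTop, IsGrown (μs M) plan (ts M) (los M) (his M)) →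
      ∀ F : Filter (ℕ × (Fin d → ℝ)), Tendsto Prod.fst F atTop →
        (∀ c ∈ C, Stable F μ c.1 c.2) →
        Tendsto (fun z => (ts z.1).eval (los z.1) (his z.1) z.2 - t.eval lo hi z.2) F (𝓝 0) := by
  induction plan generalizing lo hi with
  | leaf =>
    refine ⟨{(lo, hi)}, Set.finite_singleton _, ?_⟩
    intro μs H ts los his hlo hhi hles hts F hF hC
    obtain ⟨h1, h2⟩ := hC _ rfl
    specialize h1 los his hlo hhi
    by_cases h0 : μ {z | z.1 ∈ box lo hi} = 0
    -- On a null cell the leaf values are uncontrolled, but `F` avoids the cell and both trees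
    -- vanish off it.
    · refine tendsto_const_nhds.congr' ?_
      filter_upwards [h1, h2 h0, hF.eventually hles, hF.eventually hts] with z e1 e2 e3 e4
      rw [IsGrown.eval_eq_zero _ _ hle ht e2, e4.eval_eq_zero _ _ e3 (mt e1.1 e2), sub_zero]
    · cases t with
      | leaf α =>
        have hα : α = cellMean μ lo hi := ht h0
        have hconv := (H.tendsto_cellMean hlo hhi h0).comp hF
        rw [← hα] at hconv
        have hconv' : Tendsto (fun z : ℕ × (Fin d → ℝ) =>
            |cellMean (μs z.1) (los z.1) (his z.1) - α|) F (𝓝 0) := by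
          have := (hconv.sub_const α).abs
          simpa using this
        refine squeeze_zero_norm' ?_ hconv'
        filter_upwards [h1, hF.eventually hts,
          hF.eventually (H.eventually_measure_ne_zero hlo hhi h0)] with z e1 e2 e3
        generalize ts z.1 = T at e2
        cases T with
        | leaf β =>
          have hβ : β = cellMean (μs z.1) (los z.1) (his z.1) := e2 e3
          rw [← hβ, Real.norm_eq_abs]
          by_cases hz : z.2 ∈ box lo hi
          · simp [RegTree.eval, hz, e1.2 hz]
          · simp [RegTree.eval, hz, mt e1.1 hz]
  | node i mid pl pr ihl ihr =>
    -- Thresholds need not converge below a null box, since uniqueness is only assumed on positive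
    -- mass. The recursion stops there and the whole box is taken as a single cell.
    by_cases h0 : μ {z | z.1 ∈ box lo hi} = 0
    · refine ⟨{(lo, hi)}, Set.finite_singleton _, ?_⟩
      intro μs H ts los his hlo hhi hles hts F hF hC
      obtain ⟨h1, h2⟩ := hC _ rfl
      refine tendsto_const_nhds.congr' ?_
      filter_upwards [h1 los his hlo hhi, h2 h0, hF.eventually hles, hF.eventually hts]
        with z e1 e2 e3 e4
      rw [IsGrown.eval_eq_zero _ _ hle ht e2, e4.eval_eq_zero _ _ e3 (mt e1.1 e2), sub_zero]
    · cases t with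
      | node i' a l r =>
        have ha := ht.threshold_mem hle
        obtain ⟨rfl, hmid, hopt, hl, hr⟩ := ht
        obtain ⟨hu, hul, hur⟩ := huniq
        obtain ⟨Cl, hCl, hcl⟩ := ihl l (le_update_hi hle ha) hl hul
        obtain ⟨Cr, hCr, hcr⟩ := ihr r (update_lo_le hle ha) hr hur
        refine ⟨Cl ∪ Cr, hCl.union hCr, ?_⟩
        intro μs H ts los his hlo hhi hles hts F hF hC
        have hnode : ∀ M, ∃ i as ls rs, ts M = .node i as ls rs := fun M => by
          cases ts M
          exact ⟨_, _, _, _, rfl⟩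
        choose is as ls rs hnode using hnode
        have has : ∀ᶠ M in atTop, as M ∈ Set.Icc (los M i') (his M i') := by
          filter_upwards [hles, hts] with M h1 h2
          rw [hnode] at h2
          exact h2.threshold_mem h1
        have hconv : Tendsto as atTop (𝓝 a) := by
          cases mid
          · refine H.tendsto_threshold hlo hhi (hles.mono fun M h => h i') ?_ ha (hu rfl h0)
            filter_upwards [hts] with M h1
            rw [hnode] at h1
            exact h1.2.2.1 rfl
          · rw [hmid rfl]
            have hlim : Tendsto (fun M => (los M i' + his M i') / 2) atTop
                (𝓝 ((lo i' + hi i') / 2)) :=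
              ((tendsto_pi_nhds.1 hlo i').add (tendsto_pi_nhds.1 hhi i')).div_const 2
            refine hlim.congr' ?_
            filter_upwards [hts] with M h1
            rw [hnode] at h1
            exact (h1.2.1 rfl).symm
        have hL := hcl μs H ls los (fun M => Function.update (his M) i' (as M)) hlo
          (hhi.update i' hconv)
          (by filter_upwards [hles, has] with M h1 h2 using le_update_hi h1 h2)
          (by
            filter_upwards [hts] with M h1
            rw [hnode] at h1
            obtain ⟨h, -, -, h', -⟩ := h1
            exact h') F hF (fun c hc => hC c (Or.inl hc))
        have hR := hcr μs H rs (fun M => Function.update (los M) i' (as M)) his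
          (hlo.update i' hconv) hhi
          (by filter_upwards [hles, has] with M h1 h2 using update_lo_le h1 h2)
          (by
            filter_upwards [hts] with M h1
            rw [hnode] at h1
            obtain ⟨h, -, -, -, h'⟩ := h1
            exact h') F hF (fun c hc => hC c (Or.inr hc))
        have hsum := hL.add hR
        rw [add_zero] at hsum
        refine hsum.congr' ?_
        filter_upwards [hF.eventually hts] with z h1
        rw [hnode] at h1 ⊢
        obtain ⟨h, -⟩ := h1
        rw [RegTree.eval, RegTree.eval, h]
        ring

/-! ### Stability of boxes under perturbation. -/

theorem ae_forall_coord_ne {d : ℕ} {ν : Measure (Fin d → ℝ)} (hν : ν ≪ volume) (c : Fin d → ℝ) :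
    ∀ᵐ x ∂ν, ∀ i, x i ≠ c i := by
  refine ae_all_iff.2 fun i => ?_
  have h : volume {x : Fin d → ℝ | x i = c i} = 0 := by
    rw [volume_pi]
    exact Measure.pi_hyperplane (fun _ : Fin d => (volume : Measure ℝ)) i (c i)
  exact measure_mono_null (fun x hx => not_not.1 hx) (hν h)

/-- Off the hyperplanes carrying the faces, every defining inequality or its negation is strict,
hence an open condition on the corners. -/
theorem eventually_mem_box_iff {d : ℕ} {lo hi x : Fin d → ℝ} (hlo : ∀ i, x i ≠ lo i)
    (hhi : ∀ i, x i ≠ hi i) :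
    ∀ᶠ c in 𝓝 (lo, hi), (x ∈ box c.1 c.2 ↔ x ∈ box lo hi) := by
  have h1 : ∀ i, ∀ᶠ c : (Fin d → ℝ) × (Fin d → ℝ) in 𝓝 (lo, hi), (c.1 i ≤ x i ↔ lo i ≤ x i) :=
    fun i => by
      have hc : Tendsto (fun c : (Fin d → ℝ) × (Fin d → ℝ) => c.1 i) (𝓝 (lo, hi)) (𝓝 (lo i)) :=
        (show Continuous fun c : (Fin d → ℝ) × (Fin d → ℝ) => c.1 i by fun_prop).tendsto _
      rcases lt_or_gt_of_ne (hlo i) with h | h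
      · filter_upwards [hc.eventually (lt_mem_nhds h)] with c hc
        exact iff_of_false hc.not_ge h.not_ge
      · filter_upwards [hc.eventually (gt_mem_nhds h)] with c hc
        exact iff_of_true hc.le h.le
  have h2 : ∀ i, ∀ᶠ c : (Fin d → ℝ) × (Fin d → ℝ) in 𝓝 (lo, hi), (x i < c.2 i ↔ x i < hi i) :=
    fun i => by
      have hc : Tendsto (fun c : (Fin d → ℝ) × (Fin d → ℝ) => c.2 i) (𝓝 (lo, hi)) (𝓝 (hi i)) :=
        (show Continuous fun c : (Fin d → ℝ) × (Fin d → ℝ) => c.2 i by fun_prop).tendsto _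
      rcases lt_or_gt_of_ne (hhi i) with h | h
      · filter_upwards [hc.eventually (lt_mem_nhds h)] with c hc
        exact iff_of_true hc h
      · filter_upwards [hc.eventually (gt_mem_nhds h)] with c hc
        exact iff_of_false hc.not_gt h.not_gt
  filter_upwards [eventually_all.2 h1, eventually_all.2 h2] with c e1 e2
  simp only [mem_box]
  exact forall_congr' fun i => and_congr (e1 i) (e2 i)

theorem box_mono {d : ℕ} {lo hi lo' hi' : Fin d → ℝ} (hlo : lo' ≤ lo) (hhi : hi ≤ hi') :
    box lo hi ⊆ box lo' hi' := fun x hx => by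
  rw [mem_box] at hx ⊢
  exact fun i => ⟨(hlo i).trans (hx i).1, (hx i).2.trans_le (hhi i)⟩

theorem box_inter {d : ℕ} (lo hi lo' hi' : Fin d → ℝ) :
    box lo hi ∩ box lo' hi' = box (lo ⊔ lo') (hi ⊓ hi') := by
  ext x
  simp only [Set.mem_inter_iff, mem_box, Pi.sup_apply, Pi.inf_apply, sup_le_iff, lt_inf_iff]
  exact ⟨fun h i => ⟨⟨(h.1 i).1, (h.2 i).1⟩, (h.1 i).2, (h.2 i).2⟩,
    fun h => ⟨fun i => ⟨(h i).1.1, (h i).2.1⟩, fun i => ⟨(h i).1.2, (h i).2.2⟩⟩⟩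

/-! ### Sample averages and the law of large numbers over boxes. -/

section SampleAvg

variable {α : Type*}

/-- The average of `g` over the first `M` points of the sequence `x`. -/
noncomputable def sampleAvg (x : ℕ → α) (M : ℕ) (g : α → ℝ) : ℝ :=
  (M : ℝ)⁻¹ * ∑ m ∈ Finset.range M, g (x m)

theorem sampleAvg_mono (x : ℕ → α) (M : ℕ) {f g : α → ℝ} (h : ∀ y, f y ≤ g y) :
    sampleAvg x M f ≤ sampleAvg x M g := by
  unfold sampleAvg
  gcongr with m
  exact h _

theorem sampleAvg_nonneg (x : ℕ → α) (M : ℕ) {f : α → ℝ} (h : ∀ y, 0 ≤ f y) :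
    0 ≤ sampleAvg x M f := by
  unfold sampleAvg
  exact mul_nonneg (by positivity) (Finset.sum_nonneg fun _ _ => h _)

theorem sampleAvg_add (x : ℕ → α) (M : ℕ) (f g : α → ℝ) :
    sampleAvg x M (fun y => f y + g y) = sampleAvg x M f + sampleAvg x M g := by
  simp [sampleAvg, Finset.sum_add_distrib, mul_add]

theorem sampleAvg_sub (x : ℕ → α) (M : ℕ) (f g : α → ℝ) :
    sampleAvg x M (fun y => f y - g y) = sampleAvg x M f - sampleAvg x M g := by
  simp [sampleAvg, Finset.sum_sub_distrib, mul_sub]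

theorem sampleAvg_const_mul (x : ℕ → α) (M : ℕ) (c : ℝ) (f : α → ℝ) :
    sampleAvg x M (fun y => c * f y) = c * sampleAvg x M f := by
  simp only [sampleAvg, ← Finset.mul_sum]
  ring

theorem abs_sampleAvg_le (x : ℕ → α) (M : ℕ) (f : α → ℝ) :
    |sampleAvg x M f| ≤ sampleAvg x M (fun y => |f y|) := by
  unfold sampleAvg
  rw [abs_mul, abs_of_nonneg (by positivity : (0 : ℝ) ≤ (M : ℝ)⁻¹)]
  gcongr
  exact Finset.abs_sum_le_sum_abs _ _

/-- Weighted averages of indicators of boxes converge, locally uniformly in the box. -/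
def BoxLLN [MeasurableSpace α] {d : ℕ} (Q : Measure α) (x : ℕ → α) (π : α → Fin d → ℝ)
    (g : α → ℝ) : Prop :=
  ∀ lo hi : Fin d → ℝ,
    Tendsto (fun z : ℕ × ((Fin d → ℝ) × (Fin d → ℝ)) =>
      sampleAvg x z.1 ((π ⁻¹' box z.2.1 z.2.2).indicator g))
      (atTop ×ˢ 𝓝 (lo, hi)) (𝓝 (∫ y in π ⁻¹' box lo hi, g y ∂Q))

theorem BoxLLN.sub [MeasurableSpace α] {d : ℕ} {Q : Measure α} {x : ℕ → α} {π : α → Fin d → ℝ}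
    {f g : α → ℝ} (hf : Integrable f Q) (hg : Integrable g Q)
    (Hf : BoxLLN Q x π f) (Hg : BoxLLN Q x π g) : BoxLLN Q x π (fun y => f y - g y) := by
  intro lo hi
  rw [integral_sub hf.integrableOn hg.integrableOn]
  refine ((Hf lo hi).sub (Hg lo hi)).congr fun z => ?_
  rw [← sampleAvg_sub]
  congr 1
  ext y
  by_cases h : y ∈ π ⁻¹' box z.2.1 z.2.2 <;> simp [h]

theorem BoxLLN.tendsto_along [MeasurableSpace α] {d : ℕ} {Q : Measure α} {x : ℕ → α}
    {π : α → Fin d → ℝ} {g : α → ℝ} (H : BoxLLN Q x π g) {los his : ℕ → Fin d → ℝ}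
    {lo hi : Fin d → ℝ} (hlo : Tendsto los atTop (𝓝 lo)) (hhi : Tendsto his atTop (𝓝 hi)) :
    Tendsto (fun M => sampleAvg x M ((π ⁻¹' box (los M) (his M)).indicator g)) atTop
      (𝓝 (∫ y in π ⁻¹' box lo hi, g y ∂Q)) := by
  have key : Tendsto (fun M => (M, (los M, his M))) atTop (atTop ×ˢ 𝓝 (lo, hi)) :=
    Tendsto.prodMk tendsto_id (hlo.prodMk_nhds hhi)
  have h := Tendsto.comp (H lo hi) key
  simpa only [Function.comp_def] using h

/-- The density makes box faces null, so indicators converge almost everywhere and dominated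
convergence applies. This continuity is what lets rational boxes approximate all boxes. -/
theorem tendsto_setIntegral_box [MeasurableSpace α] {d : ℕ} {Q : Measure α}
    {π : α → Fin d → ℝ} (hπ : Measurable π) (hdens : Q.map π ≪ volume) {g : α → ℝ}
    (hint : Integrable g Q) (lo hi : Fin d → ℝ) :
    Tendsto (fun c : (Fin d → ℝ) × (Fin d → ℝ) => ∫ y in π ⁻¹' box c.1 c.2, g y ∂Q)
      (𝓝 (lo, hi)) (𝓝 (∫ y in π ⁻¹' box lo hi, g y ∂Q)) := by
  have e : ∀ c : (Fin d → ℝ) × (Fin d → ℝ), ∫ y in π ⁻¹' box c.1 c.2, g y ∂Q =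
      ∫ y, (π ⁻¹' box c.1 c.2).indicator g y ∂Q := fun c =>
    (integral_indicator (hπ (measurableSet_box _ _))).symm
  simp_rw [e]
  rw [e (lo, hi)]
  refine tendsto_integral_filter_of_dominated_convergence (fun y => ‖g y‖) ?_ ?_ hint.norm ?_
  · exact Eventually.of_forall fun c =>
      (hint.indicator (hπ (measurableSet_box _ _))).aestronglyMeasurable
  · exact Eventually.of_forall fun c => Eventually.of_forall fun y => norm_indicator_le_norm_self _ _
  · filter_upwards [ae_of_ae_map hπ.aemeasurable (ae_forall_coord_ne hdens lo),
      ae_of_ae_map hπ.aemeasurable (ae_forall_coord_ne hdens hi)] with y h1 h2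
    refine tendsto_const_nhds.congr' ?_
    filter_upwards [eventually_mem_box_iff h1 h2] with c hc
    by_cases h : π y ∈ box lo hi
    · rw [Set.indicator_of_mem (s := π ⁻¹' box lo hi) h,
        Set.indicator_of_mem (s := π ⁻¹' box c.1 c.2) (hc.2 h)]
    · rw [Set.indicator_of_notMem (s := π ⁻¹' box lo hi) h,
        Set.indicator_of_notMem (s := π ⁻¹' box c.1 c.2) (mt hc.1 h)]

theorem exists_rat_above {d : ℕ} (v : Fin d → ℝ) {ε : ℝ} (hε : 0 < ε) :
    ∃ q : Fin d → ℚ, (∀ i, v i < q i) ∧ dist (fun i => (q i : ℝ)) v < ε := by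
  choose q hq using fun i => exists_rat_btwn (lt_add_of_pos_right (v i) hε)
  refine ⟨q, fun i => (hq i).1, (dist_pi_lt_iff hε).2 fun i => ?_⟩
  rw [Real.dist_eq, abs_lt]
  constructor <;> linarith [(hq i).1, (hq i).2]

theorem exists_rat_below {d : ℕ} (v : Fin d → ℝ) {ε : ℝ} (hε : 0 < ε) :
    ∃ q : Fin d → ℚ, (∀ i, (q i : ℝ) < v i) ∧ dist (fun i => (q i : ℝ)) v < ε := by
  choose q hq using fun i => exists_rat_btwn (sub_lt_self (v i) hε)
  refine ⟨q, fun i => (hq i).2, (dist_pi_lt_iff hε).2 fun i => ?_⟩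
  rw [Real.dist_eq, abs_lt]
  constructor <;> linarith [(hq i).1, (hq i).2]

/-- By monotonicity in the box, it suffices to have convergence for rational boxes. -/
theorem boxLLN_of_rat [MeasurableSpace α] {d : ℕ} {Q : Measure α} {x : ℕ → α}
    {π : α → Fin d → ℝ} (hπ : Measurable π) (hdens : Q.map π ≪ volume) {g : α → ℝ}
    (hint : Integrable g Q) (h0 : ∀ y, 0 ≤ g y)
    (H : ∀ q r : Fin d → ℚ, Tendsto (fun M => sampleAvg x M
      ((π ⁻¹' box (fun i => (q i : ℝ)) (fun i => (r i : ℝ))).indicator g)) atTop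
      (𝓝 (∫ y in π ⁻¹' box (fun i => (q i : ℝ)) (fun i => (r i : ℝ)), g y ∂Q))) :
    BoxLLN Q x π g := by
  intro lo hi
  have hmono : ∀ (M : ℕ) {lo hi lo' hi' : Fin d → ℝ}, lo' ≤ lo → hi ≤ hi' →
      sampleAvg x M ((π ⁻¹' box lo hi).indicator g) ≤
        sampleAvg x M ((π ⁻¹' box lo' hi').indicator g) := fun M lo hi lo' hi' h1 h2 =>
    sampleAvg_mono _ _ fun y =>
      Set.indicator_le_indicator_of_subset (Set.preimage_mono (box_mono h1 h2)) h0 y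
  have hlim := tendsto_setIntegral_box hπ hdens hint lo hi
  have habove : ∀ {u v : Fin d → ℝ}, (∀ i, v i < u i) → ∀ᶠ w in 𝓝 v, w ≤ u := fun {u v} h => by
    have : ∀ i, ∀ᶠ w : Fin d → ℝ in 𝓝 v, w i ≤ u i := fun i =>
      (((continuous_apply i).tendsto v).eventually (gt_mem_nhds (h i))).mono fun w hw => le_of_lt hw
    exact eventually_all.2 this
  have hbelow : ∀ {u v : Fin d → ℝ}, (∀ i, u i < v i) → ∀ᶠ w in 𝓝 v, u ≤ w := fun {u v} h => by
    have : ∀ i, ∀ᶠ w : Fin d → ℝ in 𝓝 v, u i ≤ w i := fun i =>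
      (((continuous_apply i).tendsto v).eventually (lt_mem_nhds (h i))).mono fun w hw => le_of_lt hw
    exact eventually_all.2 this
  refine tendsto_order.2 ⟨fun a ha => ?_, fun a ha => ?_⟩
  · obtain ⟨ε, hε, hball⟩ := Metric.eventually_nhds_iff.1 (hlim.eventually (lt_mem_nhds ha))
    -- Lower bound: a rational box inside every box near `[lo, hi)`, with integral still above `a`.
    obtain ⟨q, hq, hqd⟩ := exists_rat_above lo hε
    obtain ⟨r, hr, hrd⟩ := exists_rat_below hi hε
    have hqr := @hball (fun i => (q i : ℝ), fun i => (r i : ℝ)) (by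
      rw [Prod.dist_eq]; exact max_lt hqd hrd)
    rw [nhds_prod_eq]
    filter_upwards [prod_mem_prod ((H q r).eventually (lt_mem_nhds hqr))
      (prod_mem_prod (habove hq) (hbelow hr))] with z hz
    exact lt_of_lt_of_le hz.1 (hmono _ hz.2.1 hz.2.2)
  · obtain ⟨ε, hε, hball⟩ := Metric.eventually_nhds_iff.1 (hlim.eventually (gt_mem_nhds ha))
    -- Upper bound: a rational box containing every nearby box.
    obtain ⟨q, hq, hqd⟩ := exists_rat_below lo hε
    obtain ⟨r, hr, hrd⟩ := exists_rat_above hi hε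
    have hqr := @hball (fun i => (q i : ℝ), fun i => (r i : ℝ)) (by
      rw [Prod.dist_eq]; exact max_lt hqd hrd)
    rw [nhds_prod_eq]
    filter_upwards [prod_mem_prod ((H q r).eventually (gt_mem_nhds hqr))
      (prod_mem_prod (hbelow hq) (habove hr))] with z hz
    exact lt_of_le_of_lt (hmono _ hz.2.1 hz.2.2) hz.1

theorem ae_tendsto_sampleAvg [MeasurableSpace α] {Ω : Type*} [MeasurableSpace Ω] {P : Measure Ω}
    {X : Ω → α} {Xs : ℕ → Ω → α} (hX : Measurable X) (hindep : iIndepFun Xs P)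
    (hident : ∀ m, IdentDistrib (Xs m) X P P) {g : α → ℝ} (hg : Measurable g)
    (hint : Integrable g (P.map X)) :
    ∀ᵐ ω ∂P, Tendsto (fun M => sampleAvg (fun m => Xs m ω) M g) atTop
      (𝓝 (∫ y, g y ∂P.map X)) := by
  have hid : ∀ m, IdentDistrib (g ∘ Xs m) (g ∘ X) P P := fun m => (hident m).comp hg
  have hintX : Integrable (g ∘ X) P := (integrable_map_measure hg.aestronglyMeasurable
    hX.aemeasurable).1 hint
  have h := strong_law_ae_real (μ := P) (fun m => g ∘ Xs m) ((hid 0).integrable_iff.2 hintX)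
    (fun i j hij => (hindep.indepFun hij).comp hg hg) (fun m => (hid m).trans (hid 0).symm)
  filter_upwards [h] with ω hω
  rw [integral_map hX.aemeasurable hg.aestronglyMeasurable]
  have e : ∫ ω, g (X ω) ∂P = ∫ ω, (g ∘ Xs 0) ω ∂P := (hid 0).integral_eq.symm
  rw [e]
  refine hω.congr fun M => ?_
  rw [sampleAvg, div_eq_inv_mul]
  rfl

theorem ae_boxLLN [MeasurableSpace α] {Ω : Type*} [MeasurableSpace Ω] {P : Measure Ω}
    {X : Ω → α} {Xs : ℕ → Ω → α} (hX : Measurable X) (hindep : iIndepFun Xs P)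
    (hident : ∀ m, IdentDistrib (Xs m) X P P) {d : ℕ} {π : α → Fin d → ℝ} (hπ : Measurable π)
    (hdens : (P.map X).map π ≪ volume) {g : α → ℝ} (hg : Measurable g)
    (hint : Integrable g (P.map X)) :
    ∀ᵐ ω ∂P, BoxLLN (P.map X) (fun m => Xs m ω) π g := by
  -- The sandwich between rational boxes needs a nonnegative integrand; the general case is split
  -- into positive and negative parts.
  have hnonneg : ∀ f : α → ℝ, Measurable f → Integrable f (P.map X) → (∀ y, 0 ≤ f y) →
      ∀ᵐ ω ∂P, BoxLLN (P.map X) (fun m => Xs m ω) π f := by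
    intro f hf hfi hf0
    have : ∀ᵐ ω ∂P, ∀ q r : Fin d → ℚ, Tendsto (fun M => sampleAvg (fun m => Xs m ω) M
        ((π ⁻¹' box (fun i => (q i : ℝ)) (fun i => (r i : ℝ))).indicator f)) atTop
        (𝓝 (∫ y in π ⁻¹' box (fun i => (q i : ℝ)) (fun i => (r i : ℝ)), f y ∂P.map X)) := by
      refine ae_all_iff.2 fun q => ae_all_iff.2 fun r => ?_
      have hm := hπ (measurableSet_box (fun i => (q i : ℝ)) (fun i => (r i : ℝ)))
      rw [← integral_indicator hm]
      exact ae_tendsto_sampleAvg hX hindep hident (hf.indicator hm) (hfi.indicator hm)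
    filter_upwards [this] with ω hω using boxLLN_of_rat hπ hdens hfi hf0 hω
  filter_upwards [hnonneg _ (hg.max measurable_const) hint.pos_part fun y => le_max_right _ 0,
    hnonneg _ (hg.neg.max measurable_const) hint.neg_part fun y => le_max_right _ 0] with ω h1 h2
  have := BoxLLN.sub hint.pos_part hint.neg_part h1 h2
  simpa only [max_zero_sub_max_neg_zero_eq_self] using this

/-! ### Convergence up to vanishing weighted empirical mass. -/

/-- The filter of the sets of pairs (step, point) whose complement has, under the empirical laws of
`x` weighted by `W`, vanishing mass. -/
def empiricalFilter (x : ℕ → α) (W : α → ℝ) (hW : ∀ y, 0 ≤ W y) : Filter (ℕ × α) where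
  sets := {S | Tendsto (fun M => sampleAvg x M ({y | (M, y) ∉ S}.indicator W)) atTop (𝓝 0)}
  univ_sets := by simp [sampleAvg]
  sets_of_superset := fun {S T} hS hST => squeeze_zero
    (fun M => sampleAvg_nonneg _ _ fun y => Set.indicator_nonneg (fun y _ => hW y) y)
    (fun M => sampleAvg_mono _ _ fun y => Set.indicator_le_indicator_of_subset
      (fun y (hy : (M, y) ∉ T) h => hy (hST h)) hW y) hS
  inter_sets := fun {S T} hS hT => by
    have h := Tendsto.add hS hT
    rw [add_zero] at h
    refine squeeze_zero
      (fun M => sampleAvg_nonneg _ _ fun y => Set.indicator_nonneg (fun y _ => hW y) y)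
      (fun M => ?_) h
    rw [← sampleAvg_add]
    refine sampleAvg_mono _ _ fun y => ?_
    by_cases h1 : (M, y) ∈ S <;> by_cases h2 : (M, y) ∈ T <;> simp [h1, h2, hW y]

variable {x : ℕ → α} {W : α → ℝ} {hW : ∀ y, 0 ≤ W y}

theorem eventually_empiricalFilter_iff {p : ℕ × α → Prop} :
    (∀ᶠ z in empiricalFilter x W hW, p z) ↔
      Tendsto (fun M => sampleAvg x M ({y | ¬ p (M, y)}.indicator W)) atTop (𝓝 0) := Iff.rfl

theorem tendsto_fst_empiricalFilter : Tendsto Prod.fst (empiricalFilter x W hW) atTop := by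
  refine tendsto_atTop.2 fun n => eventually_empiricalFilter_iff.2 ?_
  refine tendsto_const_nhds.congr' ?_
  filter_upwards [eventually_ge_atTop n] with M hM
  simp [hM, sampleAvg]

theorem abs_sampleAvg_sub_le (x : ℕ → α) (M : ℕ) {W G g : α → ℝ} {D : Set α}
    (hG : ∀ y, |G y| ≤ W y) (hg : ∀ y, |g y| ≤ W y) (h : ∀ y ∉ D, G y = g y) :
    |sampleAvg x M G - sampleAvg x M g| ≤ 2 * sampleAvg x M (D.indicator W) := by
  rw [← sampleAvg_sub, ← sampleAvg_const_mul]
  refine (abs_sampleAvg_le _ _ _).trans (sampleAvg_mono _ _ fun y => ?_)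
  by_cases hy : y ∈ D
  · have h1 := abs_sub (G y) (g y)
    rw [Set.indicator_of_mem hy]
    linarith [hG y, hg y]
  · simp [hy, h y hy]

/-- Comparisons with a level `Z` stabilise when the level is almost never attained. -/
theorem eventually_le_iff_of_tendsto {f : ℕ → α → ℝ} {f' Z : α → ℝ} {e : ℕ → ℝ}
    (hf : Tendsto (fun z => f z.1 z.2 - f' z.2) (empiricalFilter x W hW) (𝓝 0))
    (hZ : ∀ n : ℕ, Tendsto (fun M => sampleAvg x M
      ({y | |Z y - f' y| ≤ 1 / ((n : ℝ) + 1)}.indicator W)) atTop (𝓝 (e n)))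
    (he : Tendsto e atTop (𝓝 0)) :
    ∀ᶠ z in empiricalFilter x W hW, (f z.1 z.2 ≤ Z z.2 ↔ f' z.2 ≤ Z z.2) := by
  rw [eventually_empiricalFilter_iff]
  refine tendsto_order.2 ⟨fun a ha => Eventually.of_forall fun M => ha.trans_le
    (sampleAvg_nonneg _ _ fun y => Set.indicator_nonneg (fun y _ => hW y) y), fun a ha => ?_⟩
  -- The margin `1 / (n + 1)` is chosen so that the limiting mass of near-ties is below `a`. A
  -- comparison can change only at a near-tie or where `f M` is not within the margin of `f'`.
  obtain ⟨n, hn⟩ := (he.eventually (gt_mem_nhds ha)).exists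
  have hpos : (0 : ℝ) < 1 / ((n : ℝ) + 1) := by positivity
  have hclose := eventually_empiricalFilter_iff.1 (Metric.tendsto_nhds.1 hf _ hpos)
  have hsum := hclose.add (hZ n)
  rw [zero_add] at hsum
  filter_upwards [hsum.eventually (gt_mem_nhds hn)] with M hM
  refine lt_of_le_of_lt ?_ hM
  rw [← sampleAvg_add]
  refine sampleAvg_mono _ _ fun y => ?_
  have I1 : 0 ≤ ({y | ¬ dist (f M y - f' y) 0 < 1 / ((n : ℝ) + 1)}.indicator W) y :=
    Set.indicator_nonneg (fun y _ => hW y) y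
  have I2 : 0 ≤ ({y | |Z y - f' y| ≤ 1 / ((n : ℝ) + 1)}.indicator W) y :=
    Set.indicator_nonneg (fun y _ => hW y) y
  have I3 : ({y | ¬ (f M y ≤ Z y ↔ f' y ≤ Z y)}.indicator W) y ≤ W y :=
    Set.indicator_le_self' (fun y _ => hW y) y
  by_cases h1 : dist (f M y - f' y) 0 < 1 / ((n : ℝ) + 1)
  · by_cases h2 : |Z y - f' y| ≤ 1 / ((n : ℝ) + 1)
    · rw [Set.indicator_of_mem (s := {y | |Z y - f' y| ≤ 1 / ((n : ℝ) + 1)}) h2]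
      linarith
    · have h3 : f M y ≤ Z y ↔ f' y ≤ Z y := by
        rw [Real.dist_eq, sub_zero, abs_lt] at h1
        rcases lt_abs.1 (not_le.1 h2) with h | h
        · exact iff_of_true (by linarith) (by linarith)
        · exact iff_of_false (by linarith) (by linarith)
      rw [Set.indicator_of_notMem (s := {y | ¬ (f M y ≤ Z y ↔ f' y ≤ Z y)}) (not_not.2 h3)]
      exact add_nonneg I1 I2
  · rw [Set.indicator_of_mem (s := {y | ¬ dist (f M y - f' y) 0 < 1 / ((n : ℝ) + 1)}) h1]
    linarith

/-- The indicator of a symmetric difference is `1_A + 1_B - 2 * 1_{A ∩ B}`. Since `A ∩ B` is again a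
box with the same limit, the three averages cancel in the limit. -/
theorem stable_empiricalFilter [MeasurableSpace α] {d : ℕ} {Q : Measure α} {π : α → Fin d → ℝ}
    (H : BoxLLN Q x π W)
    {μ : Measure ((Fin d → ℝ) × ℝ)}
    (hμ : ∀ lo hi, μ {z | z.1 ∈ box lo hi} = 0 → Q (π ⁻¹' box lo hi) = 0) (lo hi : Fin d → ℝ) :
    Stable ((empiricalFilter x W hW).map (fun z => (z.1, π z.2))) μ lo hi := by
  constructor
  · intro los his hlo hhi
    rw [eventually_map, eventually_empiricalFilter_iff]
    have h1 := H.tendsto_along hlo hhi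
    have h2 := H.tendsto_along (tendsto_const_nhds (x := lo)) (tendsto_const_nhds (x := hi))
    have h3 := H.tendsto_along 
      (los := fun M => los M ⊔ lo) (his := fun M => his M ⊓ hi) (lo := lo ⊔ lo) (hi := hi ⊓ hi)
      (tendsto_pi_nhds.2 fun i => (tendsto_pi_nhds.1 hlo i).max tendsto_const_nhds)
      (tendsto_pi_nhds.2 fun i => (tendsto_pi_nhds.1 hhi i).min tendsto_const_nhds)
    have h := (h1.add h2).sub (h3.const_mul 2)
    simp only [sup_idem, inf_idem] at h
    rw [← two_mul, sub_self] at h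
    refine h.congr fun M => ?_
    rw [← sampleAvg_add, ← sampleAvg_const_mul, ← sampleAvg_sub]
    congr 1
    ext y
    have h := box_inter (los M) (his M) lo hi
    have h' : π y ∈ box (los M ⊔ lo) (his M ⊓ hi) ↔ π y ∈ box (los M) (his M) ∧ π y ∈ box lo hi := by
      rw [← h]; rfl
    by_cases e1 : π y ∈ box (los M) (his M) <;> by_cases e2 : π y ∈ box lo hi <;>
      simp [Set.indicator, h', e1, e2]
    ring
  · intro h0
    rw [eventually_map, eventually_empiricalFilter_iff]
    have h := H.tendsto_along (tendsto_const_nhds (x := lo)) (tendsto_const_nhds (x := hi))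
    rw [Measure.restrict_eq_zero.2 (hμ _ _ h0), integral_zero_measure] at h
    simp only [not_not]
    exact h

end SampleAvg

/-! ### Exercise dates, cash flows and their integrable bound. -/

theorem measurable_eval {d p : ℕ} (t : RegTree d p) (lo hi : Fin d → ℝ) :
    Measurable (t.eval lo hi) := by
  induction t generalizing lo hi with
  | leaf α => exact measurable_const.indicator (measurableSet_box lo hi)
  | node i a l r ihl ihr => exact (ihl _ _).add (ihr _ _)

theorem measurable_treeFun {d p : ℕ} (t : RegTree d p) : Measurable (treeFun t) :=
  measurable_eval t 0 1

section ExerciseDate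

variable {N d p : ℕ} (h : Fin (N + 1) → (Fin d → ℝ) → ℝ) (t : Fin N → RegTree d p)

theorem exerciseDate_last (x : Path N d) : exerciseDate h t x (Fin.last N) = Fin.last N :=
  Fin.reverseInduction_last

theorem exerciseDate_castSucc (x : Path N d) (k : Fin N) :
    exerciseDate h t x k.castSucc =
      if treeFun (t k) (x k.castSucc) ≤ h k.castSucc (x k.castSucc) then k.castSucc
      else exerciseDate h t x k.succ :=
  Fin.reverseInduction_castSucc k

theorem le_exerciseDate (x : Path N d) (j : Fin (N + 1)) : j ≤ exerciseDate h t x j := by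
  induction j using Fin.reverseInduction with
  | last => rw [exerciseDate_last]
  | cast k ih =>
    rw [exerciseDate_castSucc]
    split_ifs
    · exact le_rfl
    · exact (Fin.castSucc_lt_succ).le.trans ih

theorem exerciseDate_congr {t t' : Fin N → RegTree d p} {x : Path N d} (j : Fin (N + 1))
    (hk : ∀ k : Fin N, j ≤ k.castSucc →
      (treeFun (t k) (x k.castSucc) ≤ h k.castSucc (x k.castSucc) ↔
        treeFun (t' k) (x k.castSucc) ≤ h k.castSucc (x k.castSucc))) :
    exerciseDate h t x j = exerciseDate h t' x j := by
  induction j using Fin.reverseInduction with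
  | last => rw [exerciseDate_last, exerciseDate_last]
  | cast k ih =>
    rw [exerciseDate_castSucc, exerciseDate_castSucc,
      ih fun k' hk' => hk k' ((Fin.castSucc_lt_succ).le.trans hk')]
    simp only [hk k le_rfl]

variable {h}

theorem measurable_exerciseDate (hh : ∀ j, Measurable (h j)) (j : Fin (N + 1)) :
    Measurable fun x : Path N d => exerciseDate h t x j := by
  induction j using Fin.reverseInduction with
  | last => simpa only [exerciseDate_last] using measurable_const
  | cast k ih =>
    simp only [exerciseDate_castSucc]
    refine Measurable.ite (measurableSet_le ?_ ?_) measurable_const ih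
    · exact (measurable_treeFun (t k)).comp (measurable_pi_apply _)
    · exact (hh _).comp (measurable_pi_apply _)

theorem measurable_cashFlow (hh : ∀ j, Measurable (h j)) (j : Fin (N + 1)) :
    Measurable fun x : Path N d => cashFlow h t x j := by
  have h1 : Measurable fun z : Fin (N + 1) × Path N d => h z.1 (z.2 z.1) :=
    measurable_from_prod_countable_right fun k => (hh k).comp (measurable_pi_apply k)
  exact h1.comp ((measurable_exerciseDate t hh j).prodMk measurable_id)

variable (h)

/-- An integrable bound for the cash flows after the first date and for their squares. -/
def weight (x : Path N d) : ℝ := 1 + ∑ k : Fin N, h k.succ (x k.succ) ^ 2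

theorem weight_nonneg (x : Path N d) : 0 ≤ weight h x := by
  unfold weight; positivity

theorem abs_cashFlow_pow_le (x : Path N d) {j : Fin (N + 1)} (hj : 0 < j) {k : ℕ} (hk : k ≤ 2) :
    |cashFlow h t x j ^ k| ≤ weight h x := by
  -- Index 0, the only one missing from `weight`, is never reached from `j > 0`.
  have hpos : 0 < exerciseDate h t x j := hj.trans_le (le_exerciseDate h t x j)
  obtain ⟨i, hi⟩ := Fin.exists_succ_eq.2 hpos.ne'
  have hsq : cashFlow h t x j ^ 2 + 1 ≤ weight h x := by
    rw [cashFlow, ← hi, weight, add_comm]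
    gcongr
    exact Finset.single_le_sum (f := fun k : Fin N => h k.succ (x k.succ) ^ 2)
      (fun k _ => sq_nonneg _) (Finset.mem_univ i)
  interval_cases k
  · simp only [pow_zero, abs_one]
    linarith [sq_nonneg (cashFlow h t x j)]
  · rw [pow_one, abs_le]
    constructor <;> nlinarith [sq_nonneg (cashFlow h t x j + 1), sq_nonneg (cashFlow h t x j - 1)]
  · rw [abs_of_nonneg (sq_nonneg _)]
    linarith

theorem measurable_weight {h : Fin (N + 1) → (Fin d → ℝ) → ℝ} (hh : ∀ j, Measurable (h j)) :
    Measurable (weight h) := by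
  unfold weight
  exact measurable_const.add (Finset.measurable_fun_sum _ fun k _ =>
    ((hh _).comp (measurable_pi_apply _)).pow_const 2)

end ExerciseDate

/-! ### Moments of the regression laws. -/

section Laws

variable {N d p : ℕ} {h : Fin (N + 1) → (Fin d → ℝ) → ℝ}

theorem measurable_regressionPair (hh : ∀ j, Measurable (h j)) (t : Fin N → RegTree d p)
    (j : Fin N) : Measurable fun x : Path N d => (x j.castSucc, cashFlow h t x j.succ) :=
  (measurable_pi_apply _).prodMk (measurable_cashFlow t hh _)

theorem boxMoment_regressionLaw (hh : ∀ j, Measurable (h j)) (Q : Measure (Path N d))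
    (t : Fin N → RegTree d p) (j : Fin N) (k : ℕ) (lo hi : Fin d → ℝ) :
    boxMoment (regressionLaw Q h t j) k lo hi =
      ∫ x in (fun x : Path N d => x j.castSucc) ⁻¹' box lo hi, cashFlow h t x j.succ ^ k ∂Q := by
  rw [boxMoment, regressionLaw, setIntegral_map (measurableSet_fst_box lo hi)
    (measurable_snd.pow_const k).aestronglyMeasurable
    (measurable_regressionPair hh t j).aemeasurable]
  rfl

theorem regressionLaw_box (hh : ∀ j, Measurable (h j)) (Q : Measure (Path N d))
    (t : Fin N → RegTree d p) (j : Fin N) (lo hi : Fin d → ℝ) :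
    regressionLaw Q h t j {z | z.1 ∈ box lo hi} =
      Q ((fun x : Path N d => x j.castSucc) ⁻¹' box lo hi) := by
  rw [regressionLaw, Measure.map_apply (measurable_regressionPair hh t j)
    (measurableSet_fst_box lo hi)]
  rfl

theorem integral_empiricalLaw (x : ℕ → Path N d) (M : ℕ) (g : Path N d → ℝ) :
    ∫ y, g y ∂empiricalLaw x M = sampleAvg x M g := by
  rw [empiricalLaw, integral_smul_measure, integral_finsetSum_measure
    (fun m _ => integrable_dirac (by finiteness))]
  simp [sampleAvg]

theorem isFiniteMeasure_empiricalLaw (x : ℕ → Path N d) (M : ℕ) :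
    IsFiniteMeasure (empiricalLaw x M) := by
  -- For `M = 0` the factor `M⁻¹` is `⊤`, but it multiplies the zero measure.
  rcases Nat.eq_zero_or_pos M with rfl | hM
  · simp only [empiricalLaw, Finset.range_zero, Finset.sum_empty, smul_zero]
    infer_instance
  · exact Measure.smul_finite _ (by simp [hM.ne'])

theorem integrable_empiricalLaw (x : ℕ → Path N d) (M : ℕ) {g : Path N d → ℝ} :
    Integrable g (empiricalLaw x M) := by
  rcases Nat.eq_zero_or_pos M with rfl | hM
  · simp [empiricalLaw]
  · exact Integrable.smul_measure (integrable_finsetSum_measure.2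
      fun m _ => integrable_dirac (by finiteness)) (by simp [hM.ne'])

/-- If the cash flows given by the empirical trees eventually agree with the limiting ones, the
empirical regression laws converge on boxes. -/
theorem momentConv_regressionLaw (hh : ∀ j, Measurable (h j)) {Q : Measure (Path N d)}
    [IsFiniteMeasure Q] (hW : Integrable (weight h) Q) {x : ℕ → Path N d}
    {t : Fin N → RegTree d p} {ts : ℕ → Fin N → RegTree d p} {j : Fin N}
    (H : ∀ k ≤ 2, BoxLLN Q x (fun y => y j.castSucc) (fun y => cashFlow h t y j.succ ^ k))
    (hcash : ∀ᶠ z in empiricalFilter x (weight h) (weight_nonneg h),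
      cashFlow h (ts z.1) z.2 j.succ = cashFlow h t z.2 j.succ) :
    MomentConv (fun M => regressionLaw (empiricalLaw x M) h (ts M) j) (regressionLaw Q h t j) := by
  refine ⟨?_, ?_, ?_, ?_, ?_⟩
  · unfold regressionLaw; infer_instance
  · intro M
    have := isFiniteMeasure_empiricalLaw x M
    unfold regressionLaw; infer_instance
  · rw [regressionLaw, integrable_map_measure (measurable_snd.pow_const 2).aestronglyMeasurable
      (measurable_regressionPair hh t j).aemeasurable]
    refine hW.mono' ((measurable_cashFlow t hh j.succ).pow_const 2).aestronglyMeasurable ?_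
    exact Eventually.of_forall fun y => abs_cashFlow_pow_le h t y j.succ_pos le_rfl
  · intro M
    rw [regressionLaw, integrable_map_measure (measurable_snd.pow_const 2).aestronglyMeasurable
      (measurable_regressionPair hh (ts M) j).aemeasurable]
    exact integrable_empiricalLaw x M
  · intro k hk lo hi
    rw [boxMoment_regressionLaw hh]
    have hmain := H k hk lo hi
    -- Both integrands are bounded by `weight` and differ only where the cash flows do, so the error
    -- bound does not depend on the box.
    have herr : Tendsto (fun z : ℕ × ((Fin d → ℝ) × (Fin d → ℝ)) =>
        sampleAvg x z.1 (((fun y : Path N d => y j.castSucc) ⁻¹' box z.2.1 z.2.2).indicator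
          fun y => cashFlow h (ts z.1) y j.succ ^ k) -
        sampleAvg x z.1 (((fun y : Path N d => y j.castSucc) ⁻¹' box z.2.1 z.2.2).indicator
          fun y => cashFlow h t y j.succ ^ k)) (atTop ×ˢ 𝓝 (lo, hi)) (𝓝 0) := by
      have h2 := ((eventually_empiricalFilter_iff.1 hcash).const_mul 2).comp
        (tendsto_fst (f := atTop) (g := 𝓝 (lo, hi)))
      rw [mul_zero] at h2
      have hind : ∀ (B : Set (Path N d)) (t' : Fin N → RegTree d p) (y : Path N d),
          |B.indicator (fun y => cashFlow h t' y j.succ ^ k) y| ≤ weight h y := fun B t' y => by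
        by_cases hy : y ∈ B
        · rw [Set.indicator_of_mem hy]
          exact abs_cashFlow_pow_le h t' y j.succ_pos hk
        · rw [Set.indicator_of_notMem hy, abs_zero]
          exact weight_nonneg h y
      refine squeeze_zero_norm (fun z => ?_) h2
      refine abs_sampleAvg_sub_le x z.1 (hind _ _) (hind _ _) fun y hy => ?_
      have hy' : cashFlow h (ts z.1) y j.succ = cashFlow h t y j.succ := not_not.1 hy
      simp only [Set.indicator, hy']
    have hsum := herr.add hmain
    rw [zero_add] at hsum
    refine hsum.congr fun z => ?_
    have hm : Measurable fun y : Path N d => y j.castSucc := measurable_pi_apply _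
    rw [sub_add_cancel, boxMoment_regressionLaw hh, ← integral_empiricalLaw, integral_indicator
      (hm (measurableSet_box _ _))]

end Laws

/-! ### Backward induction over the exercise dates. -/

/-- The laws of large numbers, for the sample `x` of paths with law `Q`, behind the convergence of
the trees computed from `x` to the idealized trees `t`. -/
structure SampleLLN {N d p : ℕ} (Q : Measure (Path N d)) (h : Fin (N + 1) → (Fin d → ℝ) → ℝ)
    (t : Fin N → RegTree d p) (x : ℕ → Path N d) : Prop where
  weight : ∀ j : Fin N, 0 < (j : ℕ) → BoxLLN Q x (fun y => y j.castSucc) (weight h)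
  cashFlow : ∀ j : Fin N, 0 < (j : ℕ) → ∀ k ≤ 2,
    BoxLLN Q x (fun y => y j.castSucc) (fun y => cashFlow h t y j.succ ^ k)
  boundary : ∀ j : Fin N, 0 < (j : ℕ) → ∀ n : ℕ, Tendsto (fun M => sampleAvg x M
    ({y | |h j.castSucc (y j.castSucc) - treeFun (t j) (y j.castSucc)| ≤ 1 / ((n : ℝ) + 1)}.indicator
      (RegressionTreeLS.weight h))) atTop
    (𝓝 (∫ y in {y | |h j.castSucc (y j.castSucc) - treeFun (t j) (y j.castSucc)| ≤
      1 / ((n : ℝ) + 1)}, RegressionTreeLS.weight h y ∂Q))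

theorem IsGrown.exists_cells_tendsto_treeFun {d p : ℕ} {μ : Measure ((Fin d → ℝ) × ℝ)}
    {plan : SplitPlan d p} {t : RegTree d p} (ht : IsGrown μ plan t 0 1)
    (huniq : HasUniqueSplits μ plan t 0 1) :
    ∃ C : Set ((Fin d → ℝ) × (Fin d → ℝ)), C.Finite ∧
      ∀ (μs : ℕ → Measure ((Fin d → ℝ) × ℝ)), MomentConv μs μ →
      ∀ ts : ℕ → RegTree d p, (∀ M, 0 < M → IsGrown (μs M) plan (ts M) 0 1) →
      ∀ F : Filter (ℕ × (Fin d → ℝ)), Tendsto Prod.fst F atTop →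
        (∀ c ∈ C, Stable F μ c.1 c.2) →
        Tendsto (fun z => treeFun (ts z.1) z.2 - treeFun t z.2) F (𝓝 0) := by
  have h01 : (0 : Fin d → ℝ) ≤ 1 := zero_le_one
  obtain ⟨C, hfin, hC⟩ := ht.exists_cells_tendsto_eval plan t h01 huniq
  exact ⟨C, hfin, fun μs H ts hts F hF hst => hC μs H ts (fun _ => 0) (fun _ => 1)
    tendsto_const_nhds tendsto_const_nhds (Eventually.of_forall fun _ => h01)
    ((eventually_gt_atTop 0).mono hts) F hF hst⟩

section Convergence

variable {N d p : ℕ} {h : Fin (N + 1) → (Fin d → ℝ) → ℝ} {Q : Measure (Path N d)}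
  {t : Fin N → RegTree d p} {plan : Fin N → SplitPlan d p} {x : ℕ → Path N d}
  {ts : ℕ → Fin N → RegTree d p}

/-- The near-tie sets decrease to the set of ties, which is null. -/
theorem tendsto_integral_boundary (hh : ∀ j, Measurable (h j)) (hW : Integrable (weight h) Q)
    (j : Fin N) (hne : Q {y | h j.castSucc (y j.castSucc) = treeFun (t j) (y j.castSucc)} = 0) :
    Tendsto (fun n : ℕ => ∫ y in {y | |h j.castSucc (y j.castSucc) - treeFun (t j) (y j.castSucc)|
      ≤ 1 / ((n : ℝ) + 1)}, weight h y ∂Q) atTop (𝓝 0) := by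
  have hlim := tendsto_setIntegral_of_antitone (μ := Q) (f := weight h)
    (s := fun n : ℕ => {y : Path N d |
      |h j.castSucc (y j.castSucc) - treeFun (t j) (y j.castSucc)| ≤ 1 / ((n : ℝ) + 1)})
    (fun n => measurableSet_le (((hh _).comp (measurable_pi_apply _)).sub
      ((measurable_treeFun _).comp (measurable_pi_apply _))).abs measurable_const)
    (fun m n hmn y hy => by
      simp only [Set.mem_ofPred_eq] at hy ⊢
      exact hy.trans (Nat.one_div_le_one_div hmn)) ⟨0, hW.integrableOn⟩
  have hnull : Q (⋂ n : ℕ, {y : Path N d |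
      |h j.castSucc (y j.castSucc) - treeFun (t j) (y j.castSucc)| ≤ 1 / ((n : ℝ) + 1)}) = 0 := by
    refine measure_mono_null (fun y hy => ?_) hne
    have hy' := Set.mem_iInter.1 hy
    have h0 := ge_of_tendsto' tendsto_one_div_add_atTop_nhds_zero_nat
      (b := |h j.castSucc (y j.castSucc) - treeFun (t j) (y j.castSucc)|) fun n => hy' n
    exact sub_eq_zero.1 (abs_eq_zero.1 (le_antisymm h0 (abs_nonneg _)))
  rwa [Measure.restrict_eq_zero.2 hnull, integral_zero_measure] at hlim

/-- By backward induction, the empirical regression laws converge on boxes at every date. -/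
theorem SampleLLN.momentConv [IsFiniteMeasure Q] (hh : ∀ j, Measurable (h j))
    (hW : Integrable (RegressionTreeLS.weight h) Q)
    (ht : IsLSTrees Q h plan t)
    (huniq : ∀ j : Fin N, 0 < (j : ℕ) →
      HasUniqueSplits (regressionLaw Q h t j) (plan j) (t j) 0 1)
    (hne : ∀ j : Fin N, 0 < (j : ℕ) →
      Q {y | h j.castSucc (y j.castSucc) = treeFun (t j) (y j.castSucc)} = 0)
    (H : SampleLLN Q h t x)
    (hts : ∀ M, 0 < M → IsLSTrees (empiricalLaw x M) h plan (ts M)) (j : Fin N)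
    (hj : 0 < (j : ℕ)) :
    MomentConv (fun M => regressionLaw (empiricalLaw x M) h (ts M) j) (regressionLaw Q h t j) := by
  -- `n` bounds the distance `N - j` to the last date. The case `n = 0` is void, and the law at `j`
  -- involves only trees at dates `k > j`.
  suffices ∀ n (j : Fin N), 0 < (j : ℕ) → N ≤ j + n →
      MomentConv (fun M => regressionLaw (empiricalLaw x M) h (ts M) j) (regressionLaw Q h t j) from
    this N j hj (Nat.le_add_left _ _)
  intro n
  induction n with
  | zero => intro j _ hj'; exact absurd j.isLt (by omega)
  | succ n ih =>
    intro j hj hjn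
    refine momentConv_regressionLaw hh hW (H.cashFlow j hj) ?_
    have hdec : ∀ k : Fin N, j < k → ∀ᶠ z in empiricalFilter x (RegressionTreeLS.weight h)
        (weight_nonneg h), (treeFun (ts z.1 k) (z.2 k.castSucc) ≤ h k.castSucc (z.2 k.castSucc) ↔
          treeFun (t k) (z.2 k.castSucc) ≤ h k.castSucc (z.2 k.castSucc)) := by
      intro k hjk
      have hjk' : (j : ℕ) < k := hjk
      have hk : 0 < (k : ℕ) := hj.trans hjk'
      obtain ⟨C, -, hC⟩ := (ht k hk).exists_cells_tendsto_treeFun (huniq k hk)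
      have hfst : Tendsto Prod.fst
          ((empiricalFilter x (RegressionTreeLS.weight h) (weight_nonneg h)).map
            (fun z => (z.1, z.2 k.castSucc))) atTop := by
        rw [tendsto_map'_iff]
        exact tendsto_fst_empiricalFilter
      have hst : ∀ c ∈ C, Stable
          ((empiricalFilter x (RegressionTreeLS.weight h) (weight_nonneg h)).map
            (fun z => (z.1, z.2 k.castSucc))) (regressionLaw Q h t k) c.1 c.2 := by
        intro c _
        refine stable_empiricalFilter (π := fun y : Path N d => y k.castSucc) (H.weight k hk) ?_ _ _
        intro lo hi h0
        rwa [regressionLaw_box hh] at h0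
      have hconv := hC _ (ih k hk (by omega)) (fun M => ts M k) (fun M hM => hts M hM k hk)
        _ hfst hst
      rw [tendsto_map'_iff, Function.comp_def] at hconv
      have hlim := tendsto_integral_boundary (t := t) hh hW k (hne k hk)
      exact eventually_le_iff_of_tendsto (x := x) (W := RegressionTreeLS.weight h)
        (hW := weight_nonneg h)
        (f := fun M y => treeFun (ts M k) (y k.castSucc))
        (f' := fun y => treeFun (t k) (y k.castSucc))
        (Z := fun y => h k.castSucc (y k.castSucc))
        (e := fun n : ℕ => ∫ y in {y | |h k.castSucc (y k.castSucc) - treeFun (t k) (y k.castSucc)|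
          ≤ 1 / ((n : ℝ) + 1)}, RegressionTreeLS.weight h y ∂Q) hconv (H.boundary k hk) hlim
    have hall : ∀ᶠ z in empiricalFilter x (RegressionTreeLS.weight h) (weight_nonneg h),
        ∀ k : Fin N, j < k →
        (treeFun (ts z.1 k) (z.2 k.castSucc) ≤ h k.castSucc (z.2 k.castSucc) ↔
          treeFun (t k) (z.2 k.castSucc) ≤ h k.castSucc (z.2 k.castSucc)) :=
      eventually_all.2 fun k => by
        by_cases hjk : j < k
        · exact (hdec k hjk).mono fun z hz _ => hz
        · exact Eventually.of_forall fun z hz => absurd hz hjk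
    filter_upwards [hall] with z hz
    have := exerciseDate_congr h (t := ts z.1) (t' := t) (x := z.2) j.succ
      fun k hk => hz k (Fin.succ_le_castSucc_iff.1 hk)
    simp only [RegressionTreeLS.cashFlow, this]

/-- Stability along a filter that stays at one point, which turns convergence of trees along filters
into pointwise convergence. -/
theorem stable_of_coord_ne {μ : Measure ((Fin d → ℝ) × ℝ)} {lo hi v : Fin d → ℝ}
    (hlo : ∀ i, v i ≠ lo i) (hhi : ∀ i, v i ≠ hi i)
    (h0 : μ {z | z.1 ∈ box lo hi} = 0 → v ∉ box lo hi) :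
    Stable ((atTop : Filter ℕ).map fun M => (M, v)) μ lo hi := by
  refine ⟨fun los his hl hu => ?_, fun h => ?_⟩
  · exact eventually_map.2 ((hl.prodMk_nhds hu).eventually (eventually_mem_box_iff hlo hhi))
  · exact eventually_map.2 (Eventually.of_forall fun M => h0 h)

/-- Outside a set of paths which is null for the law of the process and depends only on the
idealized trees, the trees computed from a sample converge whenever the sample satisfies the
relevant laws of large numbers. -/
theorem exists_ae_tendsto_treeFun [IsFiniteMeasure Q] (hh : ∀ j, Measurable (h j))
    (hW : Integrable (weight h) Q) (ht : IsLSTrees Q h plan t)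
    (huniq : ∀ j : Fin N, 0 < (j : ℕ) →
      HasUniqueSplits (regressionLaw Q h t j) (plan j) (t j) 0 1)
    (hne : ∀ j : Fin N, 0 < (j : ℕ) →
      Q {y | h j.castSucc (y j.castSucc) = treeFun (t j) (y j.castSucc)} = 0)
    (j : Fin N) (hj : 0 < (j : ℕ)) (hdens : Q.map (fun y => y j.castSucc) ≪ volume) :
    ∀ᵐ y ∂Q, ∀ (x : ℕ → Path N d) (ts : ℕ → Fin N → RegTree d p), SampleLLN Q h t x →
      (∀ M, 0 < M → IsLSTrees (empiricalLaw x M) h plan (ts M)) →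
      Tendsto (fun M => treeFun (ts M j) (y j.castSucc)) atTop
        (𝓝 (treeFun (t j) (y j.castSucc))) := by
  -- The finitely many cells come from the idealized tree alone, so the null set is fixed before any
  -- sample or empirical tree is given.
  obtain ⟨C, hCfin, hC⟩ := (ht j hj).exists_cells_tendsto_treeFun (huniq j hj)
  have hstable : ∀ᵐ y ∂Q, ∀ c ∈ C, Stable ((atTop : Filter ℕ).map fun M => (M, y j.castSucc))
      (regressionLaw Q h t j) c.1 c.2 := by
    refine (ae_ball_iff hCfin.countable).2 fun c _ => ?_
    have hm : Measurable fun y : Path N d => y j.castSucc := measurable_pi_apply _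
    have h0 : ∀ᵐ y ∂Q, regressionLaw Q h t j {z | z.1 ∈ box c.1 c.2} = 0 →
        y j.castSucc ∉ box c.1 c.2 := by
      rw [regressionLaw_box hh]
      by_cases h0 : Q ((fun y : Path N d => y j.castSucc) ⁻¹' box c.1 c.2) = 0
      · filter_upwards [measure_eq_zero_iff_ae_notMem.1 h0] with y hy _ using hy
      · exact Eventually.of_forall fun y h => absurd h h0
    filter_upwards [h0, ae_of_ae_map hm.aemeasurable (ae_forall_coord_ne hdens c.1),
      ae_of_ae_map hm.aemeasurable (ae_forall_coord_ne hdens c.2)] with y h1 h2 h3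
    exact stable_of_coord_ne h2 h3 h1
  filter_upwards [hstable] with y hy x ts H hts
  have hfst : Tendsto Prod.fst ((atTop : Filter ℕ).map fun M => (M, y j.castSucc)) atTop := by
    rw [tendsto_map'_iff]
    exact tendsto_id
  have hconv := hC _ (H.momentConv hh hW ht huniq hne hts j hj) (fun M => ts M j)
    (fun M hM => hts M hM j hj) _ hfst hy
  rw [tendsto_map'_iff] at hconv
  exact tendsto_sub_nhds_zero_iff.1 hconv

end Convergence

/-! ### Almost sure validity of the laws of large numbers, and conclusion. -/

/-- Every integrand is built from the fixed trees `t`, so the strong law applies to i.i.d. terms,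
countably many times. -/
theorem ae_sampleLLN {Ω : Type*} [MeasurableSpace Ω] {P : Measure Ω} {N d p : ℕ}
    {X : Ω → Path N d} {Xs : ℕ → Ω → Path N d} (hX : Measurable X) (hindep : iIndepFun Xs P)
    (hident : ∀ m, IdentDistrib (Xs m) X P P) {h : Fin (N + 1) → (Fin d → ℝ) → ℝ}
    (hh : ∀ j, Measurable (h j)) (hW : Integrable (weight h) (P.map X))
    (hdens : ∀ j : Fin N, 0 < (j : ℕ) → (P.map X).map (fun y => y j.castSucc) ≪ volume)
    (t : Fin N → RegTree d p) :
    ∀ᵐ ω ∂P, SampleLLN (P.map X) h t (fun m => Xs m ω) := by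
  have hm : ∀ j : Fin N, Measurable fun y : Path N d => y j.castSucc :=
    fun j => measurable_pi_apply _
  have h1 : ∀ᵐ ω ∂P, ∀ j : Fin N, 0 < (j : ℕ) →
      BoxLLN (P.map X) (fun m => Xs m ω) (fun y => y j.castSucc) (weight h) :=
    ae_all_iff.2 fun j => ae_all_iff.2 fun hj =>
      ae_boxLLN hX hindep hident (hm j) (hdens j hj) (measurable_weight hh) hW
  have h2 : ∀ᵐ ω ∂P, ∀ j : Fin N, 0 < (j : ℕ) → ∀ k : ℕ, k ≤ 2 →
      BoxLLN (P.map X) (fun m => Xs m ω) (fun y => y j.castSucc)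
        (fun y => cashFlow h t y j.succ ^ k) :=
    ae_all_iff.2 fun j => ae_all_iff.2 fun hj => ae_all_iff.2 fun k => ae_all_iff.2 fun hk => by
      have hmeas := (measurable_cashFlow t hh j.succ).pow_const k
      exact ae_boxLLN hX hindep hident (hm j) (hdens j hj) hmeas
        (hW.mono' hmeas.aestronglyMeasurable
          (Eventually.of_forall fun y => abs_cashFlow_pow_le h t y j.succ_pos hk))
  have h3 : ∀ᵐ ω ∂P, ∀ j : Fin N, ∀ n : ℕ, Tendsto (fun M => sampleAvg (fun m => Xs m ω) M
      ({y | |h j.castSucc (y j.castSucc) - treeFun (t j) (y j.castSucc)| ≤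
        1 / ((n : ℝ) + 1)}.indicator (weight h))) atTop
      (𝓝 (∫ y in {y | |h j.castSucc (y j.castSucc) - treeFun (t j) (y j.castSucc)| ≤
        1 / ((n : ℝ) + 1)}, weight h y ∂P.map X)) :=
    ae_all_iff.2 fun j => ae_all_iff.2 fun n => by
      have hs : MeasurableSet {y : Path N d |
          |h j.castSucc (y j.castSucc) - treeFun (t j) (y j.castSucc)| ≤ 1 / ((n : ℝ) + 1)} :=
        measurableSet_le (((hh _).comp (hm j)).sub
          ((measurable_treeFun _).comp (hm j))).abs measurable_const
      rw [← integral_indicator hs]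
      exact ae_tendsto_sampleAvg hX hindep hident ((measurable_weight hh).indicator hs)
        (hW.indicator hs)
  filter_upwards [h1, h2, h3] with ω e1 e2 e3
  exact ⟨e1, e2, fun j _ => e3 j⟩

theorem countable_splitPlan (d p : ℕ) : Countable (SplitPlan d p) := by
  induction p with
  | zero => exact (show Function.Surjective fun _ : Unit => (SplitPlan.leaf : SplitPlan d 0) from
      fun s => by cases s; exact ⟨(), rfl⟩).countable
  | succ p ih =>
    exact (show Function.Surjective fun z : Fin d × Bool × SplitPlan d p × SplitPlan d p =>
      SplitPlan.node z.1 z.2.1 z.2.2.1 z.2.2.2 from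
        fun s => by cases s with | node i m l r => exact ⟨(i, m, l, r), rfl⟩).countable

theorem measurableSet_splitPlans {N d p : ℕ} (s : Fin N → SplitPlan d p) :
    MeasurableSet {s} := by
  have : MeasurableSingletonClass (SplitPlan d p) := ⟨fun _ => trivial⟩
  exact MeasurableSet.singleton s

end RegressionTreeLS

theorem proposition4p7
    {Ω : Type*} [MeasurableSpace Ω] (P : Measure Ω) [IsProbabilityMeasure P]
    (N d p : ℕ)
    -- the process `X` at the dates `t_0, …, t_N`, and the sampled paths
    (X : Ω → RegressionTreeLS.Path N d) (Xs : ℕ → Ω → RegressionTreeLS.Path N d)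
    (hX : Measurable X) (hXs : ∀ m, Measurable (Xs m))
    (hindep : iIndepFun Xs P) (hident : ∀ m, IdentDistrib (Xs m) X P P)
    -- for `1 ≤ j ≤ N - 1`, `X_{t_j}` lies in the unit cube and has a density
    (hcube : ∀ j : Fin N, 0 < (j : ℕ) →
      ∀ᵐ ω ∂P, X ω j.castSucc ∈ Set.Icc (0 : Fin d → ℝ) 1)
    (hdens : ∀ j : Fin N, 0 < (j : ℕ) → P.map (fun ω => X ω j.castSucc) ≪ volume)
    -- square integrable payoffs `Z_{t_j} = h_j(X_{t_j})`
    (h : Fin (N + 1) → (Fin d → ℝ) → ℝ) (hh : ∀ j, Measurable (h j))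
    (hL2 : ∀ j : Fin (N + 1), 0 < (j : ℕ) → MemLp (fun ω => h j (X ω j)) 2 P)
    -- the random splitting choices, independent of the process and of the sample
    (σ : Ω → Fin N → RegressionTreeLS.SplitPlan d p) (hσ : Measurable σ)
    (hσindep : IndepFun σ (fun ω => (X ω, fun m => Xs m ω)) P)
    -- the idealized trees, for every outcome of the splitting choices that can occur,
    -- each optimised threshold being determined by its minimisation problem
    (t : (Fin N → RegressionTreeLS.SplitPlan d p) → Fin N → RegressionTreeLS.RegTree d p)
    (ht : ∀ᵐ ω ∂P, RegressionTreeLS.IsLSTrees (P.map X) h (σ ω) (t (σ ω)))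
    (huniq : ∀ᵐ ω ∂P, ∀ j : Fin N, 0 < (j : ℕ) →
      RegressionTreeLS.HasUniqueSplits
        (RegressionTreeLS.regressionLaw (P.map X) h (t (σ ω)) j) (σ ω j) (t (σ ω) j) 0 1)
    -- the Monte Carlo trees built on the first `M` sampled paths
    (tMC : ℕ → Ω → Fin N → RegressionTreeLS.RegTree d p)
    (htMC : ∀ᵐ ω ∂P, ∀ M : ℕ, 0 < M →
      RegressionTreeLS.IsLSTrees (RegressionTreeLS.empiricalLaw (fun m => Xs m ω) M) h
        (σ ω) (tMC M ω))
    -- `P(Z_{t_j} = 𝒯_p^j(X_{t_j})) = 0`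
    (hne : ∀ j : Fin N, 0 < (j : ℕ) →
      P {ω | h j.castSucc (X ω j.castSucc) =
        RegressionTreeLS.treeFun (t (σ ω) j) (X ω j.castSucc)} = 0) :
    ∀ j : Fin N, 0 < (j : ℕ) →
      ∀ᵐ ω ∂P, Tendsto
        (fun M : ℕ => RegressionTreeLS.treeFun (tMC M ω j) (X ω j.castSucc)) atTop
        (𝓝 (RegressionTreeLS.treeFun (t (σ ω) j) (X ω j.castSucc))) := by
  have hm : ∀ j : Fin N, Measurable fun y : RegressionTreeLS.Path N d => y j.castSucc :=
    fun j => measurable_pi_apply _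
  have hQ : IsProbabilityMeasure (P.map X) := Measure.isProbabilityMeasure_map hX.aemeasurable
  have hW : Integrable (RegressionTreeLS.weight h) (P.map X) := by
    refine (integrable_const _).add (integrable_finsetSum _ fun k _ => ?_)
    have hk : Measurable fun y : RegressionTreeLS.Path N d => h k.succ (y k.succ) ^ 2 :=
      ((hh _).comp (measurable_pi_apply _)).pow_const 2
    rw [integrable_map_measure hk.aestronglyMeasurable hX.aemeasurable]
    exact (hL2 k.succ k.succ_pos).integrable_sq
  have hdensQ : ∀ j : Fin N, 0 < (j : ℕ) →
      (P.map X).map (fun y => y j.castSucc) ≪ volume := fun j hj => by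
    rw [Measure.map_map (hm j) hX]
    exact hdens j hj
  have := RegressionTreeLS.countable_splitPlan d p
  intro j hj
  suffices ∀ᵐ ω ∂P, ∀ s, σ ω = s → Tendsto
      (fun M : ℕ => RegressionTreeLS.treeFun (tMC M ω j) (X ω j.castSucc)) atTop
      (𝓝 (RegressionTreeLS.treeFun (t s j) (X ω j.castSucc))) from
    this.mono fun ω hω => hω _ rfl
  refine ae_all_iff.2 fun s => ?_
  by_cases hs : P (σ ⁻¹' {s}) = 0
  · filter_upwards [measure_eq_zero_iff_ae_notMem.1 hs] with ω hω h using absurd h hω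
  -- These almost sure properties depend on `ω` only through `σ ω`; one good outcome in the atom `σ
  -- = s` gives them for `s`.
  obtain ⟨ω₀, hω₀, hts, hus⟩ : ∃ ω, σ ω = s ∧
      RegressionTreeLS.IsLSTrees (P.map X) h (σ ω) (t (σ ω)) ∧ ∀ j : Fin N, 0 < (j : ℕ) →
        RegressionTreeLS.HasUniqueSplits
          (RegressionTreeLS.regressionLaw (P.map X) h (t (σ ω)) j) (σ ω j) (t (σ ω) j) 0 1 := by
    have hfreq : ∃ᶠ ω in ae P, σ ω = s := frequently_ae_iff.2 hs
    obtain ⟨ω, h1, h2, h3⟩ := (hfreq.and_eventually (ht.and huniq)).exists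
    exact ⟨ω, h1, h2, h3⟩
  rw [hω₀] at hts hus
  have hnes : ∀ j : Fin N, 0 < (j : ℕ) → P.map X {y | h j.castSucc (y j.castSucc) =
      RegressionTreeLS.treeFun (t s j) (y j.castSucc)} = 0 := fun j hj => by
    have hset : MeasurableSet {y : RegressionTreeLS.Path N d | h j.castSucc (y j.castSucc) =
        RegressionTreeLS.treeFun (t s j) (y j.castSucc)} :=
      measurableSet_eq_fun ((hh _).comp (hm j))
        ((RegressionTreeLS.measurable_treeFun _).comp (hm j))
    -- By independence, a tie for the trees of `s` together with `σ = s` has probability `P(σ = s) *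
    -- P(tie)`. This is zero while the first factor is not.
    have hind : IndepFun σ X P := hσindep.comp measurable_id measurable_fst
    have hprod := hind.measure_inter_preimage_eq_mul _ _
      (RegressionTreeLS.measurableSet_splitPlans s) hset
    have hzero : P (σ ⁻¹' {s} ∩ X ⁻¹' {y | h j.castSucc (y j.castSucc) =
        RegressionTreeLS.treeFun (t s j) (y j.castSucc)}) = 0 := by
      refine measure_mono_null (fun ω hω => ?_) (hne j hj)
      obtain ⟨h1, h2⟩ := hω
      rw [Set.mem_preimage, Set.mem_singleton_iff] at h1
      subst h1
      exact h2
    rw [Measure.map_apply hX hset]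
    exact (mul_eq_zero.1 (hprod.symm.trans hzero)).resolve_left hs
  -- The exceptional set for `X ω` holds for all samples at once, so the sample may depend on `X`.
  filter_upwards [htMC, RegressionTreeLS.ae_sampleLLN hX hindep hident hh hW hdensQ (t s),
    ae_of_ae_map hX.aemeasurable (RegressionTreeLS.exists_ae_tendsto_treeFun hh hW hts hus hnes
      j hj (hdensQ j hj))] with ω h1 h2 h3 hσs
  refine h3 (fun m => Xs m ω) (fun M => tMC M ω) h2 fun M hM => ?_
  rw [← hσs]
  exact h1 M hM
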